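/- **Metric TSP.** An input graph of metric TSP consists of a complete graph $G=(V,E)$ on $n$ nodes ($n\ge 3$, so that Hamiltonian cycles exist), with a port numbering of the edges incident on each node, and of an input assignment that gives each node $v$ a bit string $\mathsf I(v)$ encoding a unique identifier $id(v)$ of $O(\log n)$ bits (i.e. $id(v)<n^{c}$ for a fixed constant $c$) and the weights $w(e)$ of its incident edges in port order. Here $w$ takes positive integer values and satisfies the triangle inequality. The feasible solutions are the Hamiltonian cycles $C$ of $G$, the objective value of $C$ is $w(C)=\sum_{e\in C}w(e)$, and $OPT(G,\mathsf I)$ is the minimum objective value. **Schemes.** For $\alpha\ge 1$ and an integer $k$, an *$\alpha$-approximate decision proof labeling scheme* ($\alpha$-ADPLS) for this minimization problem and $k$ consists of a centralized prover, which assigns to each node $v$ of an input graph a label $L(v)\in\{0,1\}^*$, and of a distributed verifier, which at each node $v$ receives $\mathsf I(v)$, $L(v)$ and the vector of the labels of $v$'s neighbors in port order, and returns True or False, such that: 1. if $OPT(G,\mathsf I)\ge k$ (yes-instance), then with the prover's labels the verifier returns True at every node; 2. if $OPT(G,\mathsf I)<k/\alpha$, then for every label assignment the verifier returns False at some node. Its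 *proof size* is the maximum length of a label that the prover assigns in a yes-instance. With the parameter $k$ given as part of the input of the prover and of the verifier, the scheme is *sequentially efficient* if the prover runs, on yes-instances, in time polynomial in the number of bits that encode $k$ and the input graph, and the verifier runs at each node in time polynomial in the number of bits that encode $k$, $\mathsf I(v)$, $L(v)$ and the labels of the neighbors of $v$. (In particular, for each fixed $k$ both are polynomial in the size of their remaining input.) **Theorem.** For every constant $c$ there exists a sequentially efficient $2$-ADPLS for metric TSP (for all parameters $k\in\mathbb Z$) with proof size $O(\log n+\log W)$, where $W$ is any upper bound on the edge weights, i.e. $w:E\to\{1,\dots,W\}$, and the constant hidden in the $O$-notation depends only on $c$, not on $n$, $W$, $k$ or the input graph. -/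

import Mathlib

namespace PLS

/-! ### Bit-string encodings -/

/-- Self-delimiting code of one bit string: every bit is preceded by a marker `true`, and the
marker `false` ends the string. Its length is `2 * x.length + 1`. -/
def encString (x : List Bool) : List Bool :=
  (x.flatMap fun b => [true, b]) ++ [false]

/-- Code of a list of bit strings, used for the local inputs and outputs, and as input and output
format of the machines. -/
def encStrings (l : List (List Bool)) : List Bool :=
  l.flatMap encString

/-- Binary code of an integer: a sign bit followed by the binary digits of the absolute value
(`Nat.bits` is the binary expansion, least significant bit first). -/
def encInt (k : ℤ) : List Bool :=
  decide (k < 0) :: Nat.bits k.natAbs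

theorem encString_append_inj :
    ∀ {x y r s : List Bool}, encString x ++ r = encString y ++ s → x = y ∧ r = s
  | [], [], r, s, h => by simpa [encString] using h
  | [], b :: y, r, s, h => by simp [encString] at h
  | a :: x, [], r, s, h => by simp [encString] at h
  | a :: x, b :: y, r, s, h => by
      have h' : a = b ∧ encString x ++ r = encString y ++ s := by
        simpa [encString] using h
      obtain ⟨h1, h2⟩ := encString_append_inj h'.2
      exact ⟨by rw [h'.1, h1], h2⟩

theorem encString_ne_nil (x : List Bool) : encString x ≠ [] := by
  simp [encString]

theorem encStrings_injective : Function.Injective encStrings := by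
  intro l
  induction l with
  | nil =>
    intro m h
    cases m with
    | nil => rfl
    | cons y m => simp [encStrings, encString] at h
  | cons x l ih =>
    intro m h
    cases m with
    | nil => simp [encStrings, encString] at h
    | cons y m =>
      have h' : encString x ++ encStrings l = encString y ++ encStrings m := by
        simpa [encStrings] using h
      obtain ⟨h1, h2⟩ := encString_append_inj h'
      rw [h1, ih h2]

theorem natBits_injective : Function.Injective Nat.bits := by
  intro a b h
  have key : ∀ n : ℕ, (Nat.bits n).foldr (fun c m => Nat.bit c m) 0 = n := by
    intro n
    induction n using Nat.binaryRec' with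
    | zero => simp
    | bit c n hn ih => rw [Nat.bits_append_bit n c hn]; simp [ih]
  rw [← key a, ← key b, h]

/-! ### Graphs with port numbers, configuration graphs, IO graphs -/

/-- A finite connected undirected graph with port numbers. The node set is `Fin n`; the neighbour
of `v` behind port `i` (`i = 1, …, deg v`) is the `i`-th entry of the list `ports v`. -/
structure PortGraph where
  n : ℕ
  graph : SimpleGraph (Fin n)
  connected : graph.Connected
  ports : Fin n → List (Fin n)
  nodup_ports : ∀ v, (ports v).Nodup
  mem_ports : ∀ v u, u ∈ ports v ↔ graph.Adj v u

/-- A bit string for every node. -/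
abbrev PortGraph.Assignment (G : PortGraph) : Type := Fin G.n → List Bool

/-- A configuration graph. An input graph is a configuration graph whose states are the local
inputs. -/
structure ConfigGraph where
  G : PortGraph
  S : G.Assignment

/-- A graph with an input assignment and an output assignment. -/
structure IOGraph where
  G : PortGraph
  I : G.Assignment
  O : G.Assignment

/-- The bit string that encodes a configuration graph: for every node, the code of its state
followed by its list of neighbours in the order of the ports. -/
def ConfigGraph.encode (X : ConfigGraph) : List Bool :=
  encStrings (List.ofFn fun v : Fin X.G.n =>
    encStrings (X.S v :: (X.G.ports v).map fun u => Nat.bits u.val))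

/-! ### Gap proof labeling schemes -/

/-- What the verifier sees at a node: the node's state, its label, and the vector of its
neighbours' labels in the order of the ports. -/
structure LocalView where
  state : List Bool
  label : List Bool
  nbrLabels : List (List Bool)

/-- The local view of `v` in the configuration graph `X` under the label assignment `L`. -/
def localView (X : ConfigGraph) (L : X.G.Assignment) (v : Fin X.G.n) : LocalView where
  state := X.S v
  label := L v
  nbrLabels := (X.G.ports v).map L

/-- A gap proof labeling scheme: a centralized prover and a distributed verifier. (The labels
that the prover assigns outside the yes-family are never used.) -/
structure GPLS where
  prover : (X : ConfigGraph) → X.G.Assignment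
  verifier : LocalView → Bool

/-- The verifier accepts iff every node returns `true`. -/
def GPLS.Accepts (P : GPLS) (X : ConfigGraph) (L : X.G.Assignment) : Prop :=
  ∀ v, P.verifier (localView X L v) = true

/-- Correctness of a scheme for a yes-family and a no-family. -/
def GPLS.Correct (P : GPLS) (yes no : Set ConfigGraph) : Prop :=
  (∀ X ∈ yes, P.Accepts X (P.prover X)) ∧
  (∀ X ∈ no, ∀ L : X.G.Assignment, ¬ P.Accepts X L)

/-- The maximum length of a label that the prover assigns in `X`. -/
def GPLS.proofSize (P : GPLS) (X : ConfigGraph) : ℕ :=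
  Finset.univ.sup fun v => (P.prover X v).length

/-- The prover of the family `P` of schemes, which is given the parameter `k` and a configuration
graph of the yes-family of `k`, is computed by one multi-stack Turing machine in time polynomial
in the number of bits that encode `k` and the configuration graph. -/
def EfficientProver (P : ℤ → GPLS) (yes : ℤ → Set ConfigGraph) : Prop :=
  Nonempty (Turing.TM2ComputableInPolyTime
    (α := {x : ℤ × ConfigGraph // x.2 ∈ yes x.1})
    (fun x => encString (encInt x.1.1) ++ x.1.2.encode)
    encStrings
    (fun x => List.ofFn ((P x.1.1).prover x.1.2)))

/-- The verifier of the family `P` of schemes, which is given the parameter `k` and the local view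
of a node, is computed by one multi-stack Turing machine in time polynomial in the number of bits
that encode `k` and the local view. -/
def EfficientVerifier (P : ℤ → GPLS) : Prop :=
  Nonempty (Turing.TM2ComputableInPolyTime
    (α := ℤ × LocalView)
    (fun x => encStrings (encInt x.1 :: x.2.state :: x.2.label :: x.2.nbrLabels))
    Computability.encodeBool
    (fun x => (P x.1).verifier x.2))

/-- Both the prover and the verifier run in polynomial sequential time. -/
def SequentiallyEfficient (P : ℤ → GPLS) (yes : ℤ → Set ConfigGraph) : Prop :=
  EfficientProver P yes ∧ EfficientVerifier P

/-! ### Distributed graph minimization problems and their decision schemes -/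

/-- A distributed graph minimization problem: a collection of IO graphs with an integral
objective function on it. -/
structure MinDGP where
  feasible : Set IOGraph
  obj : feasible → ℤ

namespace MinDGP

/-- The legal input graphs: those that have a feasible solution. -/
def legal (Ψ : MinDGP) : Set ConfigGraph :=
  {X | ∃ O : X.G.Assignment, (⟨X.G, X.S, O⟩ : IOGraph) ∈ Ψ.feasible}

/-- The infimum of the objective values of the feasible solutions. -/
noncomputable def opt (Ψ : MinDGP) (X : ConfigGraph) : EReal :=
  ⨅ (O : X.G.Assignment) (h : (⟨X.G, X.S, O⟩ : IOGraph) ∈ Ψ.feasible),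
    ((Ψ.obj ⟨_, h⟩ : ℝ) : EReal)

/-- Yes-family of a decision proof labeling scheme: `OPT ≥ k`. -/
def yesFamily (Ψ : MinDGP) (k : ℤ) : Set ConfigGraph :=
  {X ∈ Ψ.legal | ((k : ℝ) : EReal) ≤ Ψ.opt X}

/-- No-family of an `α`-approximate decision proof labeling scheme: the legal input graphs
without `OPT ≥ k / α`. -/
def noFamily (Ψ : MinDGP) (α : ℝ) (k : ℤ) : Set ConfigGraph :=
  Ψ.legal \ {X ∈ Ψ.legal | (((k : ℝ) / α : ℝ) : EReal) ≤ Ψ.opt X}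

/-- `P` is an `α`-approximate decision proof labeling scheme for `Ψ` and the parameter `k`. -/
def IsADPLS (Ψ : MinDGP) (α : ℝ) (k : ℤ) (P : GPLS) : Prop :=
  P.Correct (Ψ.yesFamily k) (Ψ.noFamily α k)

end MinDGP

/-! ### Metric TSP -/

/-- The input assignment `I` encodes a metric graph: `G` is complete, the node identifiers
`ident` are distinct and consist of `O(log n)` bits (`ident v < n ^ c`), the edge weights `w` are
positive integers that satisfy the triangle inequality, and the local input of `v` holds the
identifier of `v` and the weights of the edges incident on `v` in the order of the ports. -/
structure IsMetricInstance (c : ℕ) (G : PortGraph) (I : G.Assignment)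
    (ident : Fin G.n → ℕ) (w : Sym2 (Fin G.n) → ℕ) : Prop where
  complete : G.graph = ⊤
  ident_injective : Function.Injective ident
  ident_lt : ∀ v, ident v < G.n ^ c
  weight_pos : ∀ e ∈ G.graph.edgeSet, 1 ≤ w e
  triangle : ∀ u v x, G.graph.Adj u v → G.graph.Adj v x → G.graph.Adj u x →
    w s(u, x) ≤ w s(u, v) + w s(v, x)
  input : ∀ v, I v =
    encStrings (Nat.bits (ident v) :: (G.ports v).map fun u => Nat.bits (w s(v, u)))

/-- `C` is the edge set of a Hamiltonian cycle. -/
def IsTour (G : PortGraph) (C : Finset (Sym2 (Fin G.n))) : Prop :=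
  ∃ (a : Fin G.n) (p : G.graph.Walk a a), p.IsHamiltonianCycle ∧ C = p.edges.toFinset

/-- The output assignment `O` encodes the edge set `C`: the local output of `v` is the increasing
list of the port numbers (counted from `1`) at `v` of the edges of `C`. -/
def EncodesEdges (G : PortGraph) (O : G.Assignment) (C : Finset (Sym2 (Fin G.n))) : Prop :=
  ∀ v, O v = encStrings (((G.ports v).zipIdx 1).filterMap fun x =>
    if s(v, x.1) ∈ C then some (Nat.bits x.2) else none)

/-- The metric traveling salesperson problem with node identifiers below `n ^ c`: find a
Hamiltonian cycle of minimum total weight. The weights and the cycle in the objective function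
are those that the input and the output encode; they do not depend on the choice, see
`metricTSP_obj`. -/
noncomputable def metricTSP (c : ℕ) : MinDGP where
  feasible := {x | ∃ (ident : Fin x.G.n → ℕ) (w : Sym2 (Fin x.G.n) → ℕ)
    (C : Finset (Sym2 (Fin x.G.n))),
    IsMetricInstance c x.G x.I ident w ∧ IsTour x.G C ∧ EncodesEdges x.G x.O C}
  obj := fun x =>
    ∑ e ∈ x.2.choose_spec.choose_spec.choose, (x.2.choose_spec.choose e : ℤ)

theorem IsTour.subset_edgeSet {G : PortGraph} {C : Finset (Sym2 (Fin G.n))} (h : IsTour G C) :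
    ∀ e ∈ C, e ∈ G.graph.edgeSet := by
  obtain ⟨a, p, -, rfl⟩ := h
  intro e he
  exact p.edges_subset_edgeSet (List.mem_toFinset.1 he)

theorem IsMetricInstance.weight_unique {c c' : ℕ} {G : PortGraph} {I : G.Assignment}
    {ident ident' : Fin G.n → ℕ} {w w' : Sym2 (Fin G.n) → ℕ}
    (h : IsMetricInstance c G I ident w) (h' : IsMetricInstance c' G I ident' w') :
    ∀ e ∈ G.graph.edgeSet, w e = w' e := by
  intro e
  induction e using Sym2.ind with
  | _ v u =>
    intro he
    have h1 := encStrings_injective ((h.input v).symm.trans (h'.input v))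
    have h2 := (List.cons.inj h1).2
    exact natBits_injective (List.map_inj_left.1 h2 u ((G.mem_ports v u).2 he))

theorem EncodesEdges.subset {G : PortGraph} {O : G.Assignment} {C C' : Finset (Sym2 (Fin G.n))}
    (hC : ∀ e ∈ C, e ∈ G.graph.edgeSet)
    (h : EncodesEdges G O C) (h' : EncodesEdges G O C') : C ⊆ C' := by
  intro e
  induction e using Sym2.ind with
  | _ v u =>
    intro he
    have hl := encStrings_injective ((h v).symm.trans (h' v))
    obtain ⟨j, hj⟩ := List.mem_iff_getElem?.1 ((G.mem_ports v u).2 (hC _ he))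
    have hm : (u, 1 + j) ∈ (G.ports v).zipIdx 1 :=
      List.mk_add_mem_zipIdx_iff_getElem?.2 hj
    have hb : Nat.bits (1 + j) ∈ ((G.ports v).zipIdx 1).filterMap (fun x =>
        if s(v, x.1) ∈ C then some (Nat.bits x.2) else none) :=
      List.mem_filterMap.2 ⟨(u, 1 + j), hm, by simp [he]⟩
    rw [hl] at hb
    obtain ⟨⟨u', i⟩, hm', hi⟩ := List.mem_filterMap.1 hb
    by_cases hc : s(v, u') ∈ C'
    · have hi' : i = 1 + j := natBits_injective (by simpa [hc] using hi)
      subst hi'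
      have hu : (G.ports v)[j]? = some u' := List.mk_add_mem_zipIdx_iff_getElem?.1 hm'
      rw [hj] at hu
      obtain rfl := Option.some.inj hu
      exact hc
    · simp [hc] at hi

/-- The objective value is the weight of the encoded Hamiltonian cycle under the encoded edge
weights. -/
theorem metricTSP_obj {c : ℕ} {G : PortGraph} {I O : G.Assignment}
    (hx : (⟨G, I, O⟩ : IOGraph) ∈ (metricTSP c).feasible)
    {ident : Fin G.n → ℕ} {w : Sym2 (Fin G.n) → ℕ} {C : Finset (Sym2 (Fin G.n))}
    (hI : IsMetricInstance c G I ident w) (hC : IsTour G C) (hO : EncodesEdges G O C) :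
    (metricTSP c).obj ⟨⟨G, I, O⟩, hx⟩ = ∑ e ∈ C, (w e : ℤ) := by
  obtain ⟨h1, h2, h3⟩ := hx.choose_spec.choose_spec.choose_spec
  have hCC : hx.choose_spec.choose_spec.choose = C :=
    Finset.Subset.antisymm (h3.subset h2.subset_edgeSet hO) (hO.subset hC.subset_edgeSet h3)
  change ∑ e ∈ hx.choose_spec.choose_spec.choose, (hx.choose_spec.choose e : ℤ) = _
  rw [hCC]
  refine Finset.sum_congr rfl fun e he => ?_
  rw [h1.weight_unique hI e (hC.subset_edgeSet e he)]

end PLS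

namespace PLS

/-! The certificate is a minimum spanning tree in a form that every node can check alone. In Prim's
algorithm let `ord v` be the time at which `v` enters the tree and `d v` the weight of the edge by
which it enters (zero for the first node). The label of `v` is the pair `(ord v, d v)`. Since the
graph is complete, every node sees all labels. It checks that `k ≤ 2 * ∑ d`, that its own distance
is zero unless some node has a smaller key, and, for each of its edges, that the weight is at least
`d q` for every `q` whose key lies between those of the two ends.

Yes-instances: Prim's cut property gives the edge test. Inserting the nodes one by one behind their
parents gives, by the triangle inequality, a tour of weight at most `2 * ∑ d`, hence `k ≤ OPT ≤ 2 *
∑ d` (`exists_closed_tour`, `PrimInv.step`, `IsMetricInstance.accepts`).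

Soundness: the labels need not come from a spanning tree. The edge test says that each weight
dominates the largest `d` in the interval of positions that the edge crosses. In this bottleneck
distance a path through all nodes costs at least `∑ d`, because deleting the last position `M` saves
at least `d M` (`sum_le_pathCost_bottleneck`). So every tour weighs at least `∑ d ≥ k / 2`
(`IsMetricInstance.le_of_accepts`).

Efficiency: programs on four stacks are compiled to `Turing.FinTM2`. The data are binary trees,
written as preorder words. The class `PT` of functions computed in polynomial time is closed under
composition, pairing, case distinction and folds with polynomially bounded intermediate results;
verifier and prover are assembled from these closure properties. -/

/-! ### Structured programs on four stacks -/

/-- The contents of four stacks of bits, together with a one-bit register. -/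
structure Store where
  reg : Option Bool
  s0 : List Bool
  s1 : List Bool
  s2 : List Bool
  s3 : List Bool

namespace Store

def get (s : Store) : Fin 4 → List Bool
  | 0 => s.s0
  | 1 => s.s1
  | 2 => s.s2
  | 3 => s.s3

def set (s : Store) (k : Fin 4) (x : List Bool) : Store :=
  match k with
  | 0 => { s with s0 := x }
  | 1 => { s with s1 := x }
  | 2 => { s with s2 := x }
  | 3 => { s with s3 := x }

theorem get_set (s : Store) (k : Fin 4) (x : List Bool) :
    (s.set k x).get = Function.update s.get k x := by
  funext j
  fin_cases k <;> fin_cases j <;> rfl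

theorem reg_set (s : Store) (k : Fin 4) (x : List Bool) : (s.set k x).reg = s.reg := by
  fin_cases k <;> rfl

end Store

/-- Structured programs. `pop k` moves the top of stack `k` into the register. -/
inductive Prog where
  | push (k : Fin 4) (f : Option Bool → Bool)
  | pop (k : Fin 4)
  | load (f : Option Bool → Option Bool)
  | seq (p q : Prog)
  | cond (c : Option Bool → Bool) (p q : Prog)
  | loop (c : Option Bool → Bool) (p : Prog)

/-- `Run p s t s'`: the program `p` takes the store `s` to the store `s'` with `t` jumps. -/
inductive Run : Prog → Store → ℕ → Store → Prop
  | push (k f) (s : Store) : Run (.push k f) s 0 (s.set k (f s.reg :: s.get k))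
  | pop (k) (s : Store) :
      Run (.pop k) s 0 { (s.set k (s.get k).tail) with reg := (s.get k).head? }
  | load (f) (s : Store) : Run (.load f) s 0 { s with reg := f s.reg }
  | seq {p q s t s' t' s''} : Run p s t s' → Run q s' t' s'' → Run (.seq p q) s (t + t') s''
  | condTrue {c p q t s'} {s : Store} :
      c s.reg = true → Run p s t s' → Run (.cond c p q) s t s'
  | condFalse {c p q t s'} {s : Store} :
      c s.reg = false → Run q s t s' → Run (.cond c p q) s t s'
  -- Only visits to a loop head are counted. Straight-line code and branches are part of a single
  -- machine statement and cost nothing.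
  | loopTrue {c p t s' t' s''} {s : Store} :
      c s.reg = true → Run p s t s' → Run (.loop c p) s' t' s'' →
        Run (.loop c p) s (t + t' + 1) s''
  | loopFalse {c p} {s : Store} : c s.reg = false → Run (.loop c p) s 1 s

theorem Run.seq' {p q s t s' t' s'' m} (h : Run p s t s') (h' : Run q s' t' s'')
    (hm : t + t' = m) : Run (.seq p q) s m s'' :=
  hm ▸ h.seq h'

theorem Run.straight {p q s s' t' s''} (h : Run p s 0 s') (h' : Run q s' t' s'') :
    Run (.seq p q) s t' s'' :=
  h.seq' h' (Nat.zero_add _)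

/-! ### Compilation to multi-stack Turing machines -/

namespace Prog

/-- One label for every loop of a program. -/
def Label : Prog → Type
  | push _ _ => Empty
  | pop _ => Empty
  | load _ => Empty
  | seq p q => Label p ⊕ Label q
  | cond _ p q => Label p ⊕ Label q
  | loop _ p => Option (Label p)

@[reducible]
def labelFintype : (p : Prog) → Fintype (Label p)
  | push _ _ => inferInstanceAs (Fintype Empty)
  | pop _ => inferInstanceAs (Fintype Empty)
  | load _ => inferInstanceAs (Fintype Empty)
  | seq p q =>
    letI := labelFintype p
    letI := labelFintype q
    inferInstanceAs (Fintype (Label p ⊕ Label q))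
  | cond _ p q =>
    letI := labelFintype p
    letI := labelFintype q
    inferInstanceAs (Fintype (Label p ⊕ Label q))
  | loop _ p =>
    letI := labelFintype p
    inferInstanceAs (Fintype (Option (Label p)))

/-- Statements of a machine with four stacks of bits. -/
abbrev MStmt (Λ : Type) : Type := Turing.TM2.Stmt (fun _ : Fin 4 => Bool) Λ (Option Bool)

/-- The statement that starts the program and continues with `k`. -/
def entry {Λ : Type} : (p : Prog) → (Label p → Λ) → MStmt Λ → MStmt Λ
  | push i f, _, k => .push i f k
  | pop i, _, k => .pop i (fun _ x => x) k
  | load f, _, k => .load f k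
  | seq p q, e, k => entry p (fun l => e (.inl l)) (entry q (fun l => e (.inr l)) k)
  | cond c p q, e, k =>
    .branch c (entry p (fun l => e (.inl l)) k) (entry q (fun l => e (.inr l)) k)
  -- What follows a loop is stored once, in `body`, at the label of its head, so each visit to the
  -- head is one machine step.
  | loop _ _, e, _ => .goto fun _ => e none

/-- The statements at the labels of the program, when it continues with `k`. -/
def body {Λ : Type} : (p : Prog) → (Label p → Λ) → MStmt Λ → Label p → MStmt Λ
  | push _ _, _, _, l => Empty.elim l
  | pop _, _, _, l => Empty.elim l
  | load _, _, _, l => Empty.elim l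
  | seq p q, e, k, .inl l => body p (fun l => e (.inl l)) (entry q (fun l => e (.inr l)) k) l
  | seq _ q, e, k, .inr l => body q (fun l => e (.inr l)) k l
  | cond _ p _, e, k, .inl l => body p (fun l => e (.inl l)) k l
  | cond _ _ q, e, k, .inr l => body q (fun l => e (.inr l)) k l
  | loop c p, e, k, none =>
    .branch c (entry p (fun l => e (some l)) (.goto fun _ => e none)) k
  | loop _ p, e, _, some l => body p (fun l => e (some l)) (.goto fun _ => e none) l

/-- The iterated step function of a machine. -/
abbrev steps {Λ : Type} (M : Λ → MStmt Λ) (t : ℕ)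
    (x : Turing.TM2.Cfg (fun _ : Fin 4 => Bool) Λ (Option Bool)) :
    Option (Turing.TM2.Cfg (fun _ : Fin 4 => Bool) Λ (Option Bool)) :=
  (flip bind (Turing.TM2.step M))^[t] (some x)

theorem steps_trans {Λ : Type} {M : Λ → MStmt Λ} {t t' : ℕ} {x y z}
    (h : steps M t x = some y) (h' : steps M t' y = some z) : steps M (t + t') x = some z := by
  rw [steps, Nat.add_comm, Function.iterate_add_apply]
  rw [steps] at h
  rw [h, ← h']

/-- The embedding of the labels and the continuation stay general in the induction: the continuation
of the first half of a sequence is the second half, and that of a loop body is the jump back to the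
head. -/
theorem steps_run {Λ : Type} {M : Λ → MStmt Λ} {p : Prog} {s : Store} {t : ℕ} {s' : Store}
    (h : Run p s t s') : ∀ (e : Label p → Λ) (k : MStmt Λ), (∀ l, M (e l) = body p e k l) →
      steps M t (Turing.TM2.stepAux (entry p e k) s.reg s.get) =
        some (Turing.TM2.stepAux k s'.reg s'.get) := by
  induction h with
  | push k f s => intro e k hM; simp [entry, steps, Store.get_set, Store.reg_set]
  | pop k s =>
    intro e k' hM
    simp only [entry, steps, Turing.TM2.stepAux, Function.iterate_zero, id]
    congr 2
    exact (s.get_set k _).symm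
  | load f s => intro e k hM; simp only [entry, steps, Turing.TM2.stepAux, Function.iterate_zero, id]; rfl
  | seq h h' ih ih' =>
    intro e k hM
    exact steps_trans (ih _ _ fun l => hM (.inl l)) (ih' _ _ fun l => hM (.inr l))
  | condTrue hc h ih =>
    intro e k hM
    simp only [entry, Turing.TM2.stepAux, hc, cond_true]
    exact ih _ _ fun l => hM (.inl l)
  | condFalse hc h ih =>
    intro e k hM
    simp only [entry, Turing.TM2.stepAux, hc, cond_false]
    exact ih _ _ fun l => hM (.inr l)
  | @loopTrue c p t s' t' s'' s hc h h' ih ih' =>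
    intro e k hM
    have h1 : steps M 1 (Turing.TM2.stepAux (entry (.loop c p) e k) s.reg s.get) =
        some (Turing.TM2.stepAux (entry p (fun l => e (some l)) (.goto fun _ => e none))
          s.reg s.get) := by
      have h0 : M (e none) = _ := hM none
      simp [steps, entry, flip, h0, body, hc]
    have h2 := ih (fun l => e (some l)) (.goto fun _ => e none) fun l => hM (some l)
    have h3 := ih' e k hM
    rw [Nat.add_comm]
    exact steps_trans h1 (steps_trans h2 h3)
  | @loopFalse c p s hc =>
    intro e k hM
    have h0 : M (e none) = _ := hM none
    simp [steps, entry, flip, h0, body, hc]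

/-- The machine that runs a program and halts. Input and output are on stack `0`. -/
def machine (p : Prog) : Turing.FinTM2 where
  K := Fin 4
  k₀ := 0
  k₁ := 0
  Γ := fun _ => Bool
  Λ := Option (Label p)
  main := none
  ΛFin := letI := labelFintype p; inferInstance
  σ := Option Bool
  initialState := none
  m := fun l => l.elim (entry p some .halt) (body p some .halt)

theorem machine_outputs {p : Prog} {x y : List Bool} {t m : ℕ}
    (h : Run p ⟨none, x, [], [], []⟩ t ⟨none, y, [], [], []⟩) (hm : t + 1 ≤ m) :
    Nonempty (Turing.TM2OutputsInTime (machine p) x (some y) m) := by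
  -- The additional step is the one that leaves the initial label `none`.
  have hm' : 1 + t ≤ m := by omega
  suffices hs : (flip bind (machine p).step)^[1 + t] (some (Turing.initList (machine p) x)) =
      (some y).map (Turing.haltList (machine p)) from ⟨⟨⟨1 + t, hs⟩, hm'⟩⟩
  have hinit : Turing.initList (machine p) x =
      ⟨some none, none, (⟨none, x, [], [], []⟩ : Store).get⟩ := by
    unfold Turing.initList
    congr 1
    exact funext fun k : Fin 4 => by fin_cases k <;> rfl
  have hhalt : Turing.haltList (machine p) y =
      ⟨none, none, (⟨none, y, [], [], []⟩ : Store).get⟩ := by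
    unfold Turing.haltList
    congr 1
    exact funext fun k : Fin 4 => by fin_cases k <;> rfl
  have h1 : steps (machine p).m 1 ⟨some none, none, (⟨none, x, [], [], []⟩ : Store).get⟩ =
      some (Turing.TM2.stepAux (entry p some .halt) none (⟨none, x, [], [], []⟩ : Store).get) := by
    rfl
  have h2 := steps_trans h1 (steps_run (M := (machine p).m) h some .halt fun l => rfl)
  exact (congrArg (fun c => (flip bind (machine p).step)^[1 + t] (some c)) hinit).trans
    (h2.trans (congrArg some hhalt).symm)

end Prog

/-! ### Binary trees on a stack -/

/-- Binary trees, the data on which programs compute. -/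
inductive Code where
  | nil
  | node (l r : Code)

namespace Code

/-- The preorder word of a tree. -/
def word : Code → List Bool
  | nil => [false]
  | node l r => true :: (word l ++ word r)

def size (x : Code) : ℕ := x.word.length

@[simp] theorem size_nil : size nil = 1 := rfl

@[simp] theorem size_node (l r : Code) : size (node l r) = size l + size r + 1 := by
  simp [size, word]

theorem size_pos (x : Code) : 1 ≤ x.size := by
  cases x <;> simp

end Code

namespace Prog

def skip : Prog := .load id

/-- Reads one symbol of a tree from stack `i`. Stack `3` counts the pending subtrees. -/
def walkBody (i : Fin 4) : Prog :=
  .seq (.pop i) (.seq (.push 2 (· == some true))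
    (.seq (.cond (· == some true) (.seq (.push 3 fun _ => true) (.push 3 fun _ => true)) skip)
      (.pop 3)))

/-- Moves a tree from stack `i` to stack `2`, in reverse. -/
def walk (i : Fin 4) : Prog :=
  .seq (.load fun _ => some true) (.loop (· == some true) (walkBody i))

/-- Empties stack `2` into stack `0` (if `l`) and into stack `1` (if `r`). -/
def drain (l r : Bool) : Prog :=
  .seq (.pop 2) (.loop Option.isSome
    (.seq (.cond (fun _ => l) (.push 0 (· == some true)) skip)
      (.seq (.cond (fun _ => r) (.push 1 (· == some true)) skip) (.pop 2))))

def drop : Prog := .seq (walk 0) (drain false false)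
def toAux : Prog := .seq (walk 0) (drain false true)
def fromAux : Prog := .seq (walk 1) (drain true false)
def dup : Prog := .seq (walk 0) (.seq (drain true true) fromAux)

end Prog

/-! ### Running times of the operations on trees -/

open Prog

theorem Run.skip (s : Store) : Run .skip s 0 s := .load _ _

/-- The subtree being read is not on the counter. An inner node adds its two children and the final
pop makes one pending subtree the current one, so the pop fails exactly at the end of the whole
tree. -/
theorem run_walkBody0 (z : Bool) (v a b c n) : Run (walkBody 0) ⟨v, z :: a, b, c, n⟩ 0
    ⟨((bif z then [true, true] else []) ++ n).head?, a, b, z :: c,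
      ((bif z then [true, true] else []) ++ n).tail⟩ := by
  cases z
  · exact .straight (.pop 0 _) (.straight (.push 2 _ _)
      (.straight (.condFalse rfl (.skip _)) (.pop 3 _)))
  · exact .straight (.pop 0 _) (.straight (.push 2 _ _)
      (.straight (.condTrue rfl (.straight (.push 3 _ _) (.push 3 _ _))) (.pop 3 _)))

theorem run_walkBody1 (z : Bool) (v a b c n) : Run (walkBody 1) ⟨v, a, z :: b, c, n⟩ 0
    ⟨((bif z then [true, true] else []) ++ n).head?, a, b, z :: c,
      ((bif z then [true, true] else []) ++ n).tail⟩ := by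
  cases z
  · exact .straight (.pop 1 _) (.straight (.push 2 _ _)
      (.straight (.condFalse rfl (.skip _)) (.pop 3 _)))
  · exact .straight (.pop 1 _) (.straight (.push 2 _ _)
      (.straight (.condTrue rfl (.straight (.push 3 _ _) (.push 3 _ _))) (.pop 3 _)))

/-- Stated with an arbitrary remaining run, because the same loop continues after a subtree: the
remaining run after the left subtree is the walk through the right one. -/
theorem run_walk0_loop (x : Code) : ∀ {a b c n t s'},
    Run (.loop (· == some true) (walkBody 0))
      ⟨n.head?, a, b, x.word.reverse ++ c, n.tail⟩ t s' →
    Run (.loop (· == some true) (walkBody 0)) ⟨some true, x.word ++ a, b, c, n⟩ (x.size + t) s' := by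
  induction x with
  | nil =>
    intro a b c n t s' h
    have := Run.loopTrue (c := (· == some true)) rfl (run_walkBody0 false (some true) a b c n) h
    rwa [Nat.zero_add, Nat.add_comm] at this
  | node l r ihl ihr =>
    intro a b c n t s' h
    have h1 := ihl (a := r.word ++ a) (b := b) (c := true :: c) (n := true :: n)
      (ihr (n := n) (t := t) (s' := s') (by simpa [Code.word] using h))
    have := Run.loopTrue (c := (· == some true)) rfl
      (run_walkBody0 true (some true) (l.word ++ (r.word ++ a)) b c n) h1
    convert this using 1
    · simp [Code.word]
    · simp; omega

theorem run_walk1_loop (x : Code) : ∀ {a b c n t s'},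
    Run (.loop (· == some true) (walkBody 1))
      ⟨n.head?, a, b, x.word.reverse ++ c, n.tail⟩ t s' →
    Run (.loop (· == some true) (walkBody 1)) ⟨some true, a, x.word ++ b, c, n⟩ (x.size + t) s' := by
  induction x with
  | nil =>
    intro a b c n t s' h
    have := Run.loopTrue (c := (· == some true)) rfl (run_walkBody1 false (some true) a b c n) h
    rwa [Nat.zero_add, Nat.add_comm] at this
  | node l r ihl ihr =>
    intro a b c n t s' h
    have h1 := ihl (a := a) (b := r.word ++ b) (c := true :: c) (n := true :: n)
      (ihr (n := n) (t := t) (s' := s') (by simpa [Code.word] using h))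
    have := Run.loopTrue (c := (· == some true)) rfl
      (run_walkBody1 true (some true) a (l.word ++ (r.word ++ b)) c n) h1
    convert this using 1
    · simp [Code.word]
    · simp; omega

theorem run_walk0 (x : Code) (v a b c) : Run (walk 0) ⟨v, x.word ++ a, b, c, []⟩ (x.size + 1)
    ⟨none, a, b, x.word.reverse ++ c, []⟩ :=
  .straight (.load _ _) (run_walk0_loop x (n := []) (.loopFalse rfl))

theorem run_walk1 (x : Code) (v a b c) : Run (walk 1) ⟨v, a, x.word ++ b, c, []⟩ (x.size + 1)
    ⟨none, a, b, x.word.reverse ++ c, []⟩ :=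
  .straight (.load _ _) (run_walk1_loop x (n := []) (.loopFalse rfl))

theorem run_drain (l r : Bool) (c : List Bool) : ∀ (v a b n), Run (drain l r) ⟨v, a, b, c, n⟩
    (c.length + 1) ⟨none, (bif l then c.reverse else []) ++ a,
      (bif r then c.reverse else []) ++ b, [], n⟩ := by
  intro v a b n
  refine .straight (.pop 2 _) ?_
  change Run _ ⟨c.head?, a, b, c.tail, n⟩ _ _
  induction c generalizing a b with
  | nil => cases l <;> cases r <;> exact .loopFalse rfl
  | cons z c ih =>
    have h0 : Run (.seq (.cond (fun _ => l) (.push 0 (· == some true)) Prog.skip)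
        (.seq (.cond (fun _ => r) (.push 1 (· == some true)) Prog.skip) (.pop 2)))
        ⟨some z, a, b, c, n⟩ 0
        ⟨c.head?, bif l then z :: a else a, bif r then z :: b else b, c.tail, n⟩ := by
      cases l <;> cases r <;> cases z <;>
        first
        | exact .straight (.condFalse rfl (.skip _)) (.straight (.condFalse rfl (.skip _)) (.pop 2 _))
        | exact .straight (.condTrue rfl (.push 0 _ _))
            (.straight (.condFalse rfl (.skip _)) (.pop 2 _))
        | exact .straight (.condFalse rfl (.skip _))
            (.straight (.condTrue rfl (.push 1 _ _)) (.pop 2 _))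
        | exact .straight (.condTrue rfl (.push 0 _ _))
            (.straight (.condTrue rfl (.push 1 _ _)) (.pop 2 _))
    convert Run.loopTrue (c := Option.isSome) rfl h0 (ih _ _) using 1
    all_goals cases l <;> cases r <;> simp

theorem Code.length_reverse_word (x : Code) : (x.word.reverse ++ []).length = x.size := by
  simp [Code.size]

theorem run_drop (x : Code) (v a b) : Run drop ⟨v, x.word ++ a, b, [], []⟩ (2 * x.size + 2)
    ⟨none, a, b, [], []⟩ := by
  refine (run_walk0 x v a b []).seq' (run_drain false false _ _ _ _ _) ?_
  rw [x.length_reverse_word]; ring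

theorem run_toAux (x : Code) (v a b) : Run toAux ⟨v, x.word ++ a, b, [], []⟩ (2 * x.size + 2)
    ⟨none, a, x.word ++ b, [], []⟩ := by
  have h := (run_walk0 x v a b []).seq' (run_drain false true _ _ _ _ _)
    (m := 2 * x.size + 2) (by rw [x.length_reverse_word]; ring)
  simp only [List.append_nil, List.reverse_reverse, cond_true, cond_false, List.nil_append] at h
  exact h

theorem run_fromAux (x : Code) (v a b) : Run fromAux ⟨v, a, x.word ++ b, [], []⟩
    (2 * x.size + 2) ⟨none, x.word ++ a, b, [], []⟩ := by
  have h := (run_walk1 x v a b []).seq' (run_drain true false _ _ _ _ _)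
    (m := 2 * x.size + 2) (by rw [x.length_reverse_word]; ring)
  simp only [List.append_nil, List.reverse_reverse, cond_true, cond_false, List.nil_append] at h
  exact h

theorem run_dup (x : Code) (v a b) : Run dup ⟨v, x.word ++ a, b, [], []⟩ (4 * x.size + 4)
    ⟨none, x.word ++ (x.word ++ a), b, [], []⟩ := by
  have h1 := run_drain true true (x.word.reverse ++ []) none a b []
  simp only [List.append_nil, List.reverse_reverse, cond_true] at h1
  refine (run_walk0 x v a b []).seq' ?_ (t' := 3 * x.size + 3) (by ring)
  rw [List.append_nil]
  refine h1.seq' (run_fromAux x none (x.word ++ a) b) ?_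
  simp only [List.length_reverse, Code.size]
  ring

/-! ### Functions computable in polynomial time -/

/-- Types whose elements are represented by trees. -/
class Coded (α : Type) where
  enc : α → Code

open Coded (enc)

instance : Coded Bool := ⟨fun b => bif b then .node .nil .nil else .nil⟩

instance {α β : Type} [Coded α] [Coded β] : Coded (α × β) := ⟨fun p => .node (enc p.1) (enc p.2)⟩

instance {α : Type} [Coded α] : Coded (List α) := ⟨fun l => l.foldr (fun a c => .node (enc a) c) .nil⟩

section
variable {α β γ ε : Type} [Coded α] [Coded β] [Coded γ] [Coded ε]

/-- The size of the representation. -/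
def sz (a : α) : ℕ := (enc a).size

/-- The word that represents an element. -/
def word (a : α) : List Bool := (enc a).word

@[simp] theorem sz_pair (a : α) (b : β) : sz (a, b) = sz a + sz b + 1 := Code.size_node _ _
@[simp] theorem sz_nil : sz ([] : List α) = 1 := rfl
@[simp] theorem sz_cons (a : α) (l : List α) : sz (a :: l) = sz a + sz l + 1 := Code.size_node _ _
theorem sz_true : sz true = 3 := rfl
theorem sz_false : sz false = 1 := rfl
theorem sz_bool_le (b : Bool) : sz b ≤ 3 := by cases b <;> decide
theorem sz_pos (a : α) : 1 ≤ sz a := Code.size_pos _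

theorem sz_append (l m : List α) : sz (l ++ m) + 1 = sz l + sz m := by
  induction l with
  | nil => simp [Nat.add_comm]
  | cons a l ih => simp only [List.cons_append, sz_cons]; omega

theorem length_lt_sz (l : List α) : l.length < sz l := by
  induction l with
  | nil => simp
  | cons a l ih => simp only [List.length_cons, sz_cons]; omega

theorem sz_lt_of_mem {a : α} {l : List α} (h : a ∈ l) : sz a < sz l := by
  induction l with
  | nil => simp at h
  | cons b l ih =>
    rw [sz_cons]
    rcases List.mem_cons.1 h with rfl | h
    · omega
    · have := ih h; omega

theorem sz_le_length_mul {l : List α} {B : ℕ} (h : ∀ a ∈ l, sz a ≤ B) :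
    sz l ≤ l.length * (B + 1) + 1 := by
  induction l with
  | nil => simp
  | cons a l ih =>
    have h1 := h a (by simp)
    have h2 := ih fun b hb => h b (by simp [hb])
    rw [sz_cons, List.length_cons, Nat.add_mul]
    omega

theorem word_pair (a : α) (b : β) (r : List Bool) :
    word (a, b) ++ r = true :: (word a ++ (word b ++ r)) := by
  rw [← List.append_assoc]; rfl

theorem word_cons (a : α) (l : List α) (r : List Bool) :
    word (a :: l) ++ r = true :: (word a ++ (word l ++ r)) := by
  rw [← List.append_assoc]; rfl

theorem polynomial_eval_mono (T : Polynomial ℕ) {m n : ℕ} (h : m ≤ n) : T.eval m ≤ T.eval n := by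
  simp only [Polynomial.eval_eq_sum_range]
  gcongr

/-- The program `p` takes the word of `x` to the word of `y` in at most `m` jumps. -/
def Computes (p : Prog) (x : α) (y : β) (m : ℕ) : Prop :=
  ∀ v a b, ∃ t ≤ m, Run p ⟨v, word x ++ a, b, [], []⟩ t ⟨none, word y ++ a, b, [], []⟩

theorem Computes.seq {p q : Prog} {x : α} {y : β} {z : γ} {m n : ℕ} (h : Computes p x y m)
    (h' : Computes q y z n) : Computes (.seq p q) x z (m + n) := by
  intro v a b
  obtain ⟨t, ht, hr⟩ := h v a b
  obtain ⟨t', ht', hr'⟩ := h' none a b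
  exact ⟨t + t', by omega, hr.seq hr'⟩

theorem Computes.mono {p : Prog} {x : α} {y : β} {m n : ℕ} (h : Computes p x y m) (hmn : m ≤ n) :
    Computes p x y n := fun v a b =>
  let ⟨t, ht, hr⟩ := h v a b
  ⟨t, ht.trans hmn, hr⟩

/-- Functions that are computed by programs in polynomial time. -/
@[fun_prop]
def PT (f : α → β) : Prop :=
  ∃ (p : Prog) (T : Polynomial ℕ), ∀ x, sz (f x) ≤ T.eval (sz x) ∧
    Computes p x (f x) (T.eval (sz x))

theorem PT.of_bounds {f : α → β} (p : Prog) (S T : Polynomial ℕ)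
    (h : ∀ x, sz (f x) ≤ S.eval (sz x)) (h' : ∀ x, Computes p x (f x) (T.eval (sz x))) : PT f :=
  ⟨p, S + T, fun x => by
    rw [Polynomial.eval_add]
    exact ⟨(h x).trans (Nat.le_add_right _ _), (h' x).mono (Nat.le_add_left _ _)⟩⟩

theorem PT.of_word_eq {f : α → β} (h : ∀ x, word (f x) = word x) : PT f :=
  -- Equal words need no work on the stacks, but `Computes` asks for an empty register at the end.
  ⟨.load fun _ => none, .X, fun x => by
    rw [Polynomial.eval_X]
    refine ⟨(congrArg List.length (h x)).le, fun v a b => ⟨0, Nat.zero_le _, ?_⟩⟩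
    rw [h x]
    exact .load _ _⟩

@[fun_prop]
theorem PT.id : PT (fun x : α => x) := .of_word_eq fun _ => rfl

@[fun_prop]
theorem PT.comp {g : β → γ} {f : α → β} (hg : PT g) (hf : PT f) : PT (fun x => g (f x)) := by
  obtain ⟨p, S, hp⟩ := hf
  obtain ⟨q, T, hq⟩ := hg
  -- Here the size bound in `PT` is used: the second program is polynomial in the size of the
  -- intermediate value.
  have hle : ∀ x, T.eval (sz (f x)) ≤ (T.comp S).eval (sz x) := fun x => by
    rw [Polynomial.eval_comp]
    exact polynomial_eval_mono T (hp x).1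
  refine .of_bounds (.seq p q) (T.comp S) (S + T.comp S) (fun x => (hq _).1.trans (hle x))
    fun x => ?_
  rw [Polynomial.eval_add]
  exact (hp x).2.seq ((hq _).2.mono (hle x))

/-- Pushes a word on stack `0`. -/
def Prog.pushWord : List Bool → Prog
  | [] => skip
  | z :: w => .seq (pushWord w) (.push 0 fun _ => z)

theorem run_pushWord (w : List Bool) (v a b c n) :
    Run (pushWord w) ⟨v, a, b, c, n⟩ 0 ⟨v, w ++ a, b, c, n⟩ := by
  induction w with
  | nil => exact .skip _
  | cons z w ih => exact .straight ih (.push 0 _ _)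

@[fun_prop]
theorem PT.const (y : β) : PT (fun _ : α => y) :=
  .of_bounds (.seq drop (pushWord (word y))) (Polynomial.C (sz y)) (2 * .X + 2)
    (fun x => by simp) fun x v a b => ⟨2 * sz x + 2, by simp,
      (run_drop (enc x) v a b).seq (run_pushWord _ _ _ _ _ _)⟩

@[fun_prop]
theorem PT.prodMk {f : α → β} {g : α → γ} (hf : PT f) (hg : PT g) : PT (fun x => (f x, g x)) := by
  obtain ⟨p, S, hp⟩ := hf
  obtain ⟨q, T, hq⟩ := hg
  -- The first result waits on stack `1` while the second is computed from the copy of the input.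
  -- The last push is the root symbol of the pair.
  refine .of_bounds (.seq dup (.seq p (.seq toAux (.seq q (.seq fromAux (.push 0 fun _ => true))))))
    (S + T + 1) (4 * .X + 4 + 5 * S + T + 4) (fun x => ?_) fun x v a b => ?_
  · have := (hp x).1
    have := (hq x).1
    simp only [sz_pair, Polynomial.eval_add, Polynomial.eval_one]
    omega
  · obtain ⟨t1, h1, hr1⟩ := (hp x).2 none (word x ++ a) b
    obtain ⟨t2, h2, hr2⟩ := (hq x).2 none a (word (f x) ++ b)
    have hs := (hp x).1
    have hpush : Run (.push 0 fun _ => true) ⟨none, word (f x) ++ (word (g x) ++ a), b, [], []⟩ 0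
        ⟨none, word (f x, g x) ++ a, b, [], []⟩ := by
      rw [word_pair]
      exact .push 0 _ _
    refine ⟨_, ?_, (run_dup (enc x) v a b).seq (hr1.seq ((run_toAux (enc (f x)) _ _ _).seq
      (hr2.seq ((run_fromAux (enc (f x)) _ _ _).seq hpush))))⟩
    · simp only [Polynomial.eval_add, Polynomial.eval_mul, Polynomial.eval_X,
        Polynomial.eval_ofNat]
      change 4 * sz x + 4 + (t1 + (2 * sz (f x) + 2 + (t2 + (2 * sz (f x) + 2 + 0)))) ≤ _
      omega

@[fun_prop]
theorem PT.fst : PT (Prod.fst : α × β → α) := by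
  refine .of_bounds (.seq (.pop 0) (.seq toAux (.seq drop fromAux))) .X (4 * .X + 6)
    (fun x => ?_) fun ⟨x, y⟩ v a b => ?_
  · rw [Polynomial.eval_X]
    change _ ≤ sz (x.1, x.2)
    rw [sz_pair]
    omega
  · rw [word_pair]
    refine ⟨_, ?_, .straight (.pop 0 _) ((run_toAux (enc x) _ _ _).seq
      ((run_drop (enc y) _ _ _).seq (run_fromAux (enc x) _ _ _)))⟩
    simp only [Polynomial.eval_add, Polynomial.eval_mul, Polynomial.eval_X,
      Polynomial.eval_ofNat, sz_pair]
    change 2 * sz x + 2 + (2 * sz y + 2 + (2 * sz x + 2)) ≤ _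
    omega

@[fun_prop]
theorem PT.snd : PT (Prod.snd : α × β → β) := by
  refine .of_bounds (.seq (.pop 0) drop) .X (4 * .X + 6)
    (fun x => ?_) fun ⟨x, y⟩ v a b => ?_
  · rw [Polynomial.eval_X]
    change _ ≤ sz (x.1, x.2)
    rw [sz_pair]
    omega
  · rw [word_pair]
    refine ⟨_, ?_, .straight (.pop 0 _) (run_drop (enc x) _ _ _)⟩
    simp only [Polynomial.eval_add, Polynomial.eval_mul, Polynomial.eval_X,
      Polynomial.eval_ofNat, sz_pair]
    change 2 * sz x + 2 ≤ _
    omega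

@[fun_prop]
theorem PT.cond {c : α → Bool} {f g : α → β} (hc : PT c) (hf : PT f) (hg : PT g) :
    PT (fun x => bif c x then f x else g x) := by
  obtain ⟨r, R, hr⟩ := hc
  obtain ⟨p, S, hp⟩ := hf
  obtain ⟨q, T, hq⟩ := hg
  -- The word of `true` has three symbols and that of `false` has one, so the positive branch has
  -- two more symbols to remove.
  refine .of_bounds (.seq dup (.seq r (.seq (.pop 0)
    (.cond (· == some true) (.seq (.pop 0) (.seq (.pop 0) p)) q))))
    (S + T) (4 * .X + 4 + R + S + T) (fun x => ?_) fun x v a b => ?_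
  · have := (hp x).1
    have := (hq x).1
    rw [Polynomial.eval_add]
    cases c x <;> simp only [cond_true, cond_false] <;> omega
  · obtain ⟨t0, h0, hr0⟩ := (hr x).2 none (word x ++ a) b
    have key : ∃ t ≤ S.eval (sz x) + T.eval (sz x), Run (.seq (.pop 0)
        (.cond (· == some true) (.seq (.pop 0) (.seq (.pop 0) p)) q))
        ⟨none, word (c x) ++ (word x ++ a), b, [], []⟩ t
        ⟨none, word (bif c x then f x else g x) ++ a, b, [], []⟩ := by
      cases c x with
      | true =>
        obtain ⟨t, ht, h⟩ := (hp x).2 (some false) a b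
        exact ⟨t, by omega, .straight (.pop 0 _) (.condTrue rfl
          (.straight (.pop 0 _) (.straight (.pop 0 _) h)))⟩
      | false =>
        obtain ⟨t, ht, h⟩ := (hq x).2 (some false) a b
        exact ⟨t, by omega, .straight (.pop 0 _) (.condFalse rfl h)⟩
    obtain ⟨t1, h1, hr1⟩ := key
    refine ⟨_, ?_, (run_dup (enc x) v a b).seq (hr0.seq hr1)⟩
    simp only [Polynomial.eval_add, Polynomial.eval_mul, Polynomial.eval_X,
      Polynomial.eval_ofNat]
    change 4 * sz x + 4 + (t0 + t1) ≤ _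
    omega

theorem PT.cons_aux : PT (fun p : α × List α => p.1 :: p.2) := .of_word_eq fun _ => rfl

@[fun_prop]
theorem PT.cons {f : ε → α} {g : ε → List α} (hf : PT f) (hg : PT g) :
    PT (fun e => f e :: g e) := cons_aux.comp (hf.prodMk hg)

theorem PT.listCases {g : ε → List α} {i : ε → β} {f : (α × List α) × ε → β} (hg : PT g)
    (hi : PT i) (hf : PT f) :
    PT (fun e => match g e with
      | [] => i e
      | a :: l => f ((a, l), e)) := by
  obtain ⟨r, R, hr⟩ := hg
  obtain ⟨p, S, hp⟩ := hi
  obtain ⟨q, T, hq⟩ := hf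
  have hT : ∀ e a l, g e = a :: l →
      T.eval (sz ((a, l), e)) ≤ (T.comp (R + .X + 1)).eval (sz e) := by
    intro e a l h
    rw [Polynomial.eval_comp]
    refine polynomial_eval_mono T ?_
    have := (hr e).1
    rw [h, sz_cons] at this
    simp only [sz_pair, Polynomial.eval_add, Polynomial.eval_X, Polynomial.eval_one]
    omega
  -- A nonempty list and the pair of its head and tail have the same word. One push restores the
  -- root symbol that was popped for the test, the other is the root of the pair with `e`.
  refine .of_bounds (.seq dup (.seq r (.seq (.pop 0) (.cond (· == some true)
    (.seq (.push 0 fun _ => true) (.seq (.push 0 fun _ => true) q)) p))))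
    (S + T.comp (R + .X + 1)) (4 * .X + 4 + R + (S + T.comp (R + .X + 1))) (fun e => ?_)
    fun e v a b => ?_
  · rw [Polynomial.eval_add]
    have := (hp e).1
    split
    · omega
    · next x l h =>
      have := (hq ((x, l), e)).1
      have := hT e x l h
      omega
  · obtain ⟨t0, h0, hr0⟩ := (hr e).2 none (word e ++ a) b
    have key : ∃ t ≤ (S + T.comp (R + .X + 1)).eval (sz e), Run (.seq (.pop 0)
        (.cond (· == some true)
          (.seq (.push 0 fun _ => true) (.seq (.push 0 fun _ => true) q)) p))
        ⟨none, word (g e) ++ (word e ++ a), b, [], []⟩ t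
        ⟨none, word (match g e with
          | [] => i e
          | a :: l => f ((a, l), e)) ++ a, b, [], []⟩ := by
      rw [Polynomial.eval_add]
      split
      · next h =>
        obtain ⟨t, ht, h'⟩ := (hp e).2 (some false) a b
        rw [h]
        exact ⟨t, by omega, .straight (.pop 0 _) (.condFalse rfl h')⟩
      · next x l h =>
        obtain ⟨t, ht, h'⟩ := (hq ((x, l), e)).2 (some true) a b
        have := hT e x l h
        rw [h, word_cons]
        rw [word_pair, word_pair] at h'
        exact ⟨t, by omega, .straight (.pop 0 _) (.condTrue rfl
          (.straight (.push 0 _ _) (.straight (.push 0 _ _) h')))⟩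
    obtain ⟨t1, h1, hr1⟩ := key
    refine ⟨_, ?_, (run_dup (enc e) v a b).seq (hr0.seq hr1)⟩
    rw [Polynomial.eval_add, Polynomial.eval_add]
    simp only [Polynomial.eval_add, Polynomial.eval_mul, Polynomial.eval_X,
      Polynomial.eval_ofNat] at h1 ⊢
    change 4 * sz e + 4 + (t0 + t1) ≤ _
    omega

/-! ### Iteration over lists -/

theorem sz_le_of_suffix {l m : List α} (h : l <:+ m) : sz l ≤ sz m := by
  obtain ⟨k, rfl⟩ := h
  have := sz_append k l
  have := sz_pos k
  omega

theorem sz_le_of_prefix {l m : List α} (h : l <+: m) : sz l ≤ sz m := by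
  obtain ⟨k, rfl⟩ := h
  have := sz_append l k
  have := sz_pos k
  omega

/-- Runs `p` on a pair as long as the first component is a nonempty list. -/
def Prog.forEach (p : Prog) : Prog :=
  -- The first pop takes off the root of the pair, the second the root of the list, which is the
  -- loop condition. Both are put back before `p` runs, and the last `load` clears the `false` left
  -- in the register.
  .seq (.pop 0) (.seq (.seq (.pop 0) (.loop (· == some true)
    (.seq (.push 0 fun _ => true) (.seq (.push 0 fun _ => true)
      (.seq p (.seq (.pop 0) (.pop 0))))))) (.load fun _ => none))

theorem computes_forEach {f : β → α → β} {p : Prog} {B : ℕ} (l : List α) :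
    ∀ y : β, (∀ a m m', m ++ a :: m' = l →
      Computes p (a :: m', m.foldl f y) (m', f (m.foldl f y) a) B) →
    Computes (forEach p) (l, y) (l.foldl f y) (l.length * (B + 1) + 1) := by
  suffices h : ∀ y : β, (∀ a m m', m ++ a :: m' = l →
      Computes p (a :: m', m.foldl f y) (m', f (m.foldl f y) a) B) → ∀ v a b,
      ∃ t ≤ l.length * (B + 1) + 1, Run (.seq (.pop 0) (.loop (· == some true)
        (.seq (.push 0 fun _ => true) (.seq (.push 0 fun _ => true)
          (.seq p (.seq (.pop 0) (.pop 0)))))))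
        ⟨v, word l ++ (word y ++ a), b, [], []⟩ t
        ⟨some false, word (l.foldl f y) ++ a, b, [], []⟩ by
    intro y hy v a b
    obtain ⟨t, ht, hr⟩ := h y hy (some true) a b
    rw [word_pair]
    exact ⟨t, ht, .straight (.pop 0 _) (hr.seq' (.load _ _) rfl)⟩
  induction l with
  | nil =>
    intro y hy v a b
    exact ⟨1, by simp, .straight (.pop 0 _) (.loopFalse rfl)⟩
  | cons x l ih =>
    intro y hy v a b
    obtain ⟨t1, h1, hr1⟩ := hy x [] l rfl (some true) a b
    obtain ⟨t2, h2, hr2⟩ := ih (f y x) (fun z m m' h => hy z (x :: m) m' (by simp [h])) (some true) a b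
    rw [word_pair, word_pair, word_cons] at hr1
    rw [word_cons]
    -- The run on the remaining list begins with the pop that already closes the present pass;
    -- inversion exposes the loop behind it.
    cases hr2 with
    | seq hp hl =>
      cases hp
      refine ⟨_, ?_, .straight (.pop 0 _) (.loopTrue rfl
        (.straight (.push 0 _ _) (.straight (.push 0 _ _) (hr1.seq (.straight (.pop 0 _) (.pop 0 _))))) hl)⟩
      rw [List.length_cons, Nat.add_mul]
      omega

/-- Iteration over a list, with a polynomial bound on the intermediate results. -/
theorem PT.foldl {g : ε → List α} {i : ε → β} {f : ε → β → α → β} (hg : PT g) (hi : PT i)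
    (hf : PT fun x : (ε × β) × α => f x.1.1 x.1.2 x.2)
    (hb : ∃ q : Polynomial ℕ, ∀ e l, l <+: g e → sz (l.foldl (f e) (i e)) ≤ q.eval (sz e)) :
    PT fun e => (g e).foldl (f e) (i e) := by
  obtain ⟨q, hq⟩ := hb
  -- The parameter `e` is carried along in the accumulator, because the program of a step sees only
  -- the current state.
  have hstep : PT fun s : List α × (ε × β) => match s.1 with
      | [] => s
      | a :: l => (l, (s.2.1, f s.2.1 s.2.2 a)) := by
    refine PT.listCases (f := fun x : (α × List α) × (List α × (ε × β)) =>
      (x.1.2, (x.2.2.1, f x.2.2.1 x.2.2.2 x.1.1))) PT.fst PT.id ?_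
    refine .prodMk (by fun_prop) (.prodMk (by fun_prop) ?_)
    exact hf.comp (f := fun x : (α × List α) × (List α × (ε × β)) =>
      ((x.2.2.1, x.2.2.2), x.1.1)) (by fun_prop)
  have hinit : PT fun e => (g e, (e, i e)) := by fun_prop
  obtain ⟨p, S, hp⟩ := hstep
  obtain ⟨p0, S0, hp0⟩ := hinit
  obtain ⟨p1, S1, hp1⟩ := (PT.snd : PT (Prod.snd : ε × β → β))
  have hfold : ∀ e (l : List α) y, l.foldl (fun (s : ε × β) a => (s.1, f s.1 s.2 a)) (e, y) =
      (e, l.foldl (f e) y) := by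
    intro e l
    induction l with
    | nil => intro y; rfl
    | cons a l ih => intro y; exact ih _
  -- `Q` bounds the time of one step. The bound `q` on all intermediate results is essential: size
  -- bounds composed once per list element need not stay polynomial.
  set Q : Polynomial ℕ := S.comp (S0 + .X + q + 2)
  refine .of_bounds (.seq p0 (.seq (forEach p) p1)) q
    (S0 + (S0 * (Q + 1) + 1 + S1.comp (.X + q + 1))) (fun e => hq e _ (List.prefix_refl _))
    fun e => ?_
  have hsz := (hp0 e).1
  rw [sz_pair, sz_pair] at hsz
  have h1 : Computes (forEach p) (g e, (e, i e)) (e, (g e).foldl (f e) (i e))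
      ((g e).length * (Q.eval (sz e) + 1) + 1) := by
    have := computes_forEach (f := fun (s : ε × β) a => (s.1, f s.1 s.2 a)) (p := p)
      (B := Q.eval (sz e)) (g e) (e, i e) ?_
    · rwa [hfold] at this
    · intro a m m' hm
      rw [hfold]
      refine ((hp _).2).mono ?_
      rw [Polynomial.eval_comp]
      refine polynomial_eval_mono _ ?_
      have h2 := hq e m ⟨_, hm⟩
      have h3 := sz_le_of_suffix (⟨m, hm⟩ : a :: m' <:+ g e)
      simp only [sz_pair, Polynomial.eval_add, Polynomial.eval_X, Polynomial.eval_ofNat]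
      omega
  refine ((hp0 e).2.seq (h1.seq (hp1 _).2)).mono ?_
  simp only [Polynomial.eval_add, Polynomial.eval_mul, Polynomial.eval_one]
  have h4 : (g e).length ≤ S0.eval (sz e) := by
    have := length_lt_sz (g e)
    omega
  have h5 : S1.eval (sz (e, (g e).foldl (f e) (i e))) ≤ (S1.comp (.X + q + 1)).eval (sz e) := by
    rw [Polynomial.eval_comp]
    refine polynomial_eval_mono _ ?_
    have h2 := hq e _ (List.prefix_refl _)
    simp only [sz_pair, Polynomial.eval_add, Polynomial.eval_X, Polynomial.eval_one]
    omega
  gcongr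

/-- Iteration over a list, where every step enlarges the result by a polynomially bounded amount. -/
theorem PT.foldl_of_le_add {g : ε → List α} {i : ε → β} {f : ε → β → α → β} (hg : PT g) (hi : PT i)
    (hf : PT fun x : (ε × β) × α => f x.1.1 x.1.2 x.2)
    (hb : ∃ q : Polynomial ℕ, ∀ e y a, a ∈ g e → sz (f e y a) ≤ sz y + q.eval (sz e)) :
    PT fun e => (g e).foldl (f e) (i e) := by
  refine .foldl hg hi hf ?_
  obtain ⟨q, hq⟩ := hb
  obtain ⟨p, S, hS⟩ := hg
  obtain ⟨r, R, hR⟩ := hi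
  refine ⟨R + S * q, fun e l hl => ?_⟩
  have h1 : ∀ (l : List α) (y : β), (∀ a ∈ l, a ∈ g e) →
      sz (l.foldl (f e) y) ≤ sz y + l.length * q.eval (sz e) := by
    intro l
    induction l with
    | nil => intro y _; simp
    | cons a l ih =>
      intro y h
      have h1 := ih (f e y a) fun b hb => h b (by simp [hb])
      have h2 := hq e y a (h a (by simp))
      rw [List.foldl_cons, List.length_cons, Nat.add_mul]
      omega
  refine (h1 l (i e) fun a ha => hl.subset ha).trans ?_
  rw [Polynomial.eval_add, Polynomial.eval_mul]
  have h2 := (hR e).1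
  have h3 : l.length ≤ S.eval (sz e) :=
    hl.length_le.trans ((length_lt_sz _).le.trans (hS e).1)
  gcongr

end

/-! ### Raw bit strings as input and output -/

namespace Prog

/-- Replaces the bit string on stack `0` by its word. -/
def read : Prog :=
  .seq (.seq (.pop 0) (.loop Option.isSome (.seq (.push 2 (· == some true)) (.pop 0))))
    (.seq (.push 0 fun _ => false) (.seq (.pop 2) (.loop Option.isSome
      (.seq (.cond (· == some true)
          (.seq (.push 0 fun _ => false) (.seq (.push 0 fun _ => false) (.push 0 fun _ => true)))
          (.push 0 fun _ => false))
        (.seq (.push 0 fun _ => true) (.pop 2))))))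

/-- Replaces the word of a bit string on stack `0` by the bit string. -/
def write : Prog :=
  .seq (.seq (.pop 0) (.loop (· == some true)
    (.seq (.pop 0) (.seq
      (.cond (· == some true) (.seq (.pop 0) (.seq (.pop 0) (.push 2 fun _ => true)))
        (.push 2 fun _ => false)) (.pop 0))))) (drain true false)

end Prog

theorem run_read_fst (x : List Bool) : ∀ c,
    Run (.loop Option.isSome (.seq (.push 2 (· == some true)) (.pop 0)))
      ⟨x.head?, x.tail, [], c, []⟩ (x.length + 1) ⟨none, [], [], x.reverse ++ c, []⟩ := by
  induction x with
  | nil => intro c; exact .loopFalse rfl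
  | cons z x ih =>
    intro c
    have h0 : Run (.seq (.push 2 (· == some true)) (.pop 0)) ⟨some z, x, [], c, []⟩ 0
        ⟨x.head?, x.tail, [], z :: c, []⟩ := by
      cases z <;> exact .straight (.push 2 _ _) (.pop 0 _)
    have := Run.loopTrue (c := Option.isSome) rfl h0 (ih (z :: c))
    simpa using this

theorem run_read_snd (x : List Bool) : ∀ y : List Bool,
    Run (.loop Option.isSome
      (.seq (.cond (· == some true)
          (.seq (.push 0 fun _ => false) (.seq (.push 0 fun _ => false) (.push 0 fun _ => true)))
          (.push 0 fun _ => false))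
        (.seq (.push 0 fun _ => true) (.pop 2))))
      ⟨x.head?, word y, [], x.tail, []⟩ (x.length + 1)
      ⟨none, word (x.reverse ++ y), [], [], []⟩ := by
  induction x with
  | nil => intro c; exact .loopFalse rfl
  | cons z x ih =>
    intro y
    have h0 : Run (.seq (.cond (· == some true)
          (.seq (.push 0 fun _ => false) (.seq (.push 0 fun _ => false) (.push 0 fun _ => true)))
          (.push 0 fun _ => false))
        (.seq (.push 0 fun _ => true) (.pop 2))) ⟨some z, word y, [], x, []⟩ 0
        ⟨x.head?, word (z :: y), [], x.tail, []⟩ := by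
      cases z
      · exact .straight (.condFalse rfl (.push 0 _ _)) (.straight (.push 0 _ _) (.pop 2 _))
      · exact .straight (.condTrue rfl
          (.straight (.push 0 _ _) (.straight (.push 0 _ _) (.push 0 _ _))))
          (.straight (.push 0 _ _) (.pop 2 _))
    have := Run.loopTrue (c := Option.isSome) rfl h0 (ih (z :: y))
    simpa using this

theorem run_read (x : List Bool) : Run read ⟨none, x, [], [], []⟩ (2 * x.length + 2)
    ⟨none, word x, [], [], []⟩ := by
  have h1 := run_read_fst x []
  have h2 := run_read_snd x.reverse []
  simp only [List.append_nil, List.length_reverse, List.reverse_reverse] at h1 h2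
  exact Run.seq' (.straight (.pop 0 _) h1) (.straight (.push 0 _ _) (.straight (.pop 2 _) h2))
    (by ring)

theorem run_write_loop (y : List Bool) : ∀ v c,
    Run (.seq (.pop 0) (.loop (· == some true)
      (.seq (.pop 0) (.seq
        (.cond (· == some true) (.seq (.pop 0) (.seq (.pop 0) (.push 2 fun _ => true)))
          (.push 2 fun _ => false)) (.pop 0)))))
      ⟨v, word y, [], c, []⟩ (y.length + 1) ⟨some false, [], [], y.reverse ++ c, []⟩ := by
  induction y with
  | nil => intro v c; exact .straight (.pop 0 _) (.loopFalse rfl)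
  | cons z y ih =>
    intro v c
    obtain hr := ih (some z) (z :: c)
    generalize ht : y.length + 1 = t at hr
    cases hr with
    | seq hp hl =>
      cases hp
      refine .straight (.pop 0 _) ?_
      have h0 : Run (.seq (.pop 0) (.seq
        (.cond (· == some true) (.seq (.pop 0) (.seq (.pop 0) (.push 2 fun _ => true)))
          (.push 2 fun _ => false)) (.pop 0))) ⟨some true, word z ++ word y, [], c, []⟩ 0
          ⟨(word y).head?, (word y).tail, [], z :: c, []⟩ := by
        cases z
        · exact .straight (.pop 0 _) (.straight (.condFalse rfl (.push 2 _ _)) (.pop 0 _))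
        · exact .straight (.pop 0 _) (.straight (.condTrue rfl
            (.straight (.pop 0 _) (.straight (.pop 0 _) (.push 2 _ _)))) (.pop 0 _))
      have := Run.loopTrue (c := (· == some true)) rfl h0 hl
      rw [Nat.zero_add] at this
      rw [List.length_cons, List.reverse_cons, List.append_assoc, ht, Nat.zero_add]
      exact this

theorem run_write (y : List Bool) (v) : Run write ⟨v, word y, [], [], []⟩ (2 * y.length + 2)
    ⟨none, y, [], [], []⟩ := by
  have h1 := run_write_loop y v []
  have h2 := run_drain true false y.reverse (some false) [] [] []
  simp only [List.append_nil, List.length_reverse, List.reverse_reverse] at h1 h2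
  exact h1.seq' h2 (by ring)

theorem sz_bits_le (x : List Bool) : sz x ≤ 4 * x.length + 1 := by
  have := sz_le_length_mul (l := x) (B := 3) fun b _ => sz_bool_le b
  omega

/-- A function that agrees on codes with a function of the class `PT` on bit strings is computed
by a Turing machine in polynomial time. -/
theorem PT.turing {F : List Bool → List Bool} (hF : PT F) {α β : Type} (ea : α → List Bool)
    (eb : β → List Bool) (g : α → β) (h : ∀ a, eb (g a) = F (ea a)) :
    Nonempty (Turing.TM2ComputableInPolyTime ea eb g) := by
  obtain ⟨p, T, hp⟩ := hF
  have key : ∀ a, Nonempty (Turing.TM2OutputsInTime (machine (.seq read (.seq p write))) (ea a)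
      (some (eb (g a))) ((2 * .X + 5 + 3 * T.comp (4 * .X + 1) : Polynomial ℕ).eval
        (ea a).length)) := by
    intro a
    obtain ⟨t, ht, hr⟩ := (hp (ea a)).2 none [] []
    rw [List.append_nil, List.append_nil, ← h] at hr
    refine machine_outputs ((run_read _).seq (hr.seq (run_write _ _))) ?_
    have h1 := polynomial_eval_mono T (sz_bits_le (ea a))
    have h2 := (hp (ea a)).1
    have h3 := length_lt_sz (F (ea a))
    rw [← h] at h3
    simp only [Polynomial.eval_add, Polynomial.eval_mul, Polynomial.eval_comp, Polynomial.eval_X,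
      Polynomial.eval_ofNat, Polynomial.eval_one]
    rw [← h] at h2
    omega
  refine ⟨⟨⟨machine (.seq read (.seq p write)), Equiv.refl Bool, Equiv.refl Bool⟩,
    2 * .X + 5 + 3 * T.comp (4 * .X + 1), fun a => ?_⟩⟩
  have h1 : ∀ l : List Bool, l.map (Equiv.refl Bool).invFun = l := fun l => l.map_id
  exact cast (by erw [h1, h1]) (key a).some

/-! ### Operations on lists -/

/-- Pairs the elements of the first list with those of the second list, which is extended by `d`
if it is shorter. -/
def zipD {α β : Type} (d : β) : List α → List β → List (α × β)
  | [], _ => []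
  | a :: l, m => (a, m.headD d) :: zipD d l m.tail

theorem zipD_eq_zip {α β : Type} (d : β) : ∀ {l : List α} {m : List β}, l.length = m.length →
    zipD d l m = l.zip m
  | [], [], _ => rfl
  | a :: l, b :: m, h => by simp [zipD, zipD_eq_zip d (Nat.succ.inj h)]

section
variable {α β γ ε : Type} [Coded α] [Coded β] [Coded γ] [Coded ε]

@[fun_prop]
theorem PT.not {f : ε → Bool} (hf : PT f) : PT fun e => !f e := by
  have : PT fun e => bif f e then false else true := by fun_prop
  convert this using 2 with e
  cases f e <;> rfl

@[fun_prop]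
theorem PT.and {f g : ε → Bool} (hf : PT f) (hg : PT g) : PT fun e => f e && g e := by
  have : PT fun e => bif f e then g e else false := by fun_prop
  convert this using 2 with e
  cases f e <;> rfl

@[fun_prop]
theorem PT.or {f g : ε → Bool} (hf : PT f) (hg : PT g) : PT fun e => f e || g e := by
  have : PT fun e => bif f e then true else g e := by fun_prop
  convert this using 2 with e
  cases f e <;> rfl

@[fun_prop]
theorem PT.headD {g : ε → List α} {d : ε → α} (hg : PT g) (hd : PT d) :
    PT fun e => (g e).headD (d e) := by
  have := PT.listCases (f := fun x : (α × List α) × ε => x.1.1) hg hd (by fun_prop)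
  convert this using 2 with e
  cases g e <;> rfl

@[fun_prop]
theorem PT.tail {g : ε → List α} (hg : PT g) : PT fun e => (g e).tail := by
  have := PT.listCases (i := fun _ => []) (f := fun x : (α × List α) × ε => x.1.2) hg
    (by fun_prop) (by fun_prop)
  convert this using 2 with e
  cases g e <;> rfl

/-- The values of a function of the class `PT` have polynomially bounded size. -/
theorem PT.exists_sz_le {g : ε → β} (hg : PT g) :
    ∃ q : Polynomial ℕ, ∀ e, sz (g e) ≤ q.eval (sz e) := by
  obtain ⟨p, T, h⟩ := hg
  exact ⟨T, fun e => (h e).1⟩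

@[fun_prop]
theorem PT.reverse {g : ε → List α} (hg : PT g) : PT fun e => (g e).reverse := by
  obtain ⟨q, hq⟩ := hg.exists_sz_le
  have := PT.foldl_of_le_add (i := fun _ => []) (f := fun _ (y : List α) a => a :: y) hg
    (by fun_prop) (by fun_prop) ⟨q, fun e y a ha => by
      have := hq e
      have := sz_lt_of_mem ha
      rw [sz_cons]
      omega⟩
  simpa using this

@[fun_prop]
theorem PT.append {f g : ε → List α} (hf : PT f) (hg : PT g) : PT fun e => f e ++ g e := by
  obtain ⟨q, hq⟩ := hf.exists_sz_le
  have := PT.foldl_of_le_add (f := fun _ (y : List α) a => a :: y) hf.reverse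
    hg (by fun_prop) ⟨q, fun e y a ha => by
      have := hq e
      have := sz_lt_of_mem (List.mem_reverse.1 ha)
      rw [sz_cons]
      omega⟩
  simpa using this

theorem PT.flatMap {g : ε → List α} {f : ε → α → List β} (hg : PT g)
    (hf : PT fun x : ε × α => f x.1 x.2) : PT fun e => (g e).flatMap (f e) := by
  obtain ⟨q, hq⟩ := hg.exists_sz_le
  obtain ⟨r, hr⟩ := hf.exists_sz_le
  have := PT.foldl_of_le_add (i := fun _ => []) (f := fun e (y : List β) a => y ++ f e a) hg
    (by fun_prop) (.append (by fun_prop) (hf.comp (f := fun x : (ε × List β) × α => (x.1.1, x.2))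
      (by fun_prop))) ⟨r.comp (.X + q), fun e y a ha => by
      have h1 := sz_append y (f e a)
      have h2 := hr (e, a)
      have h3 := hq e
      have h4 := sz_lt_of_mem ha
      have h5 : sz (e, a) ≤ sz e + q.eval (sz e) := by rw [sz_pair]; omega
      have h6 := polynomial_eval_mono r h5
      simp only [Polynomial.eval_comp, Polynomial.eval_add, Polynomial.eval_X]
      dsimp only at h2
      omega⟩
  convert this using 2 with e
  have h : ∀ (l : List α) (y : List β),
      l.foldl (fun y a => y ++ f e a) y = y ++ l.flatMap (f e) := by
    intro l
    induction l with
    | nil => simp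
    | cons a l ih => intro y; simp [ih]
  simp [h]

theorem PT.map {g : ε → List α} {f : ε → α → β} (hg : PT g)
    (hf : PT fun x : ε × α => f x.1 x.2) : PT fun e => (g e).map (f e) := by
  have := PT.flatMap (f := fun e a => [f e a]) hg (by fun_prop)
  simpa only [List.flatMap_singleton', List.map_eq_flatMap] using this

theorem PT.filter {g : ε → List α} {f : ε → α → Bool} (hg : PT g)
    (hf : PT fun x : ε × α => f x.1 x.2) : PT fun e => (g e).filter (f e) := by
  have := PT.flatMap (f := fun e a => bif f e a then [a] else []) hg (by fun_prop)
  convert this using 2 with e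
  induction g e with
  | nil => rfl
  | cons a l ih => cases h : f e a <;> simp [h, ih]

theorem PT.all {g : ε → List α} {f : ε → α → Bool} (hg : PT g)
    (hf : PT fun x : ε × α => f x.1 x.2) : PT fun e => (g e).all (f e) := by
  have := PT.foldl_of_le_add (i := fun _ => true) (f := fun e (y : Bool) a => y && f e a) hg
    (by fun_prop) (.and (by fun_prop) (hf.comp (f := fun x : (ε × Bool) × α => (x.1.1, x.2))
      (by fun_prop))) ⟨3, fun e y a ha => by
      have := sz_bool_le (y && f e a)
      simp only [Polynomial.eval_ofNat]
      omega⟩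
  convert this using 2 with e
  have h : ∀ (l : List α) (y : Bool),
      l.foldl (fun y a => y && f e a) y = (y && l.all (f e)) := by
    intro l
    induction l with
    | nil => simp
    | cons a l ih => intro y; simp [ih, Bool.and_assoc]
  simp [h]

theorem PT.any {g : ε → List α} {f : ε → α → Bool} (hg : PT g)
    (hf : PT fun x : ε × α => f x.1 x.2) : PT fun e => (g e).any (f e) := by
  have := (PT.all (f := fun e a => !f e a) hg (by fun_prop)).not
  simpa [List.not_all_eq_any_not] using this

@[fun_prop]
theorem PT.zipD {g : ε → List α} {h : ε → List β} (d : β) (hg : PT g) (hh : PT h) :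
    PT fun e => zipD d (g e) (h e) := by
  obtain ⟨q, hq⟩ := hg.exists_sz_le
  have := PT.foldl_of_le_add (i := fun e => (h e, []))
    (f := fun _ (y : List β × List (α × β)) a => (y.1.tail, (a, y.1.headD d) :: y.2)) hg
    (by fun_prop) (by fun_prop) ⟨q + Polynomial.C (sz d) + 2, fun e y a ha => by
      have h1 := hq e
      have h2 := sz_lt_of_mem ha
      obtain ⟨y1, y2⟩ := y
      cases y1 <;> simp <;> omega⟩
  have := (PT.snd.comp this).reverse
  convert this using 2 with e
  have h : ∀ (l : List α) (m : List β) (k : List (α × β)),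
      (l.foldl (fun (y : List β × List (α × β)) a => (y.1.tail, (a, y.1.headD d) :: y.2))
        (m, k)).2 = (PLS.zipD d l m).reverse ++ k := by
    intro l
    induction l with
    | nil => intro m k; rfl
    | cons a l ih => intro m k; rw [List.foldl_cons, ih]; simp [PLS.zipD]
  rw [h, List.append_nil, List.reverse_reverse]

end

/-! ### Binary numbers -/

/-- Binary numbers, least significant bit first. -/
abbrev Bits : Type := List Bool

/-- The value of a binary number, which may have leading zeros. -/
def val : Bits → ℕ
  | [] => 0
  | b :: l => b.toNat + 2 * val l

@[simp] theorem val_nil : val [] = 0 := rfl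
@[simp] theorem val_cons (b : Bool) (l : Bits) : val (b :: l) = b.toNat + 2 * val l := rfl

@[simp] theorem val_bits (n : ℕ) : val (Nat.bits n) = n := by
  induction n using Nat.binaryRec' with
  | zero => simp
  | bit c n hn ih =>
    rw [Nat.bits_append_bit n c hn, val_cons, ih, Nat.bit_val]
    omega

theorem val_append_zeros (a : Bits) (l : Bits) : val (a ++ l.map fun _ => false) = val a := by
  induction a with
  | nil => induction l with
    | nil => rfl
    | cons b l ih => simpa using ih
  | cons b a ih => rw [List.cons_append, val_cons, val_cons, ih]

theorem map_fst_zipD {α β : Type} (d : β) : ∀ (l : List α) (m : List β),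
    (zipD d l m).map Prod.fst = l
  | [], _ => rfl
  | a :: l, m => by simp [zipD, map_fst_zipD d l]

theorem val_map_snd_zipD {α : Type} : ∀ (l : List α) (m : Bits), m.length ≤ l.length →
    val ((zipD false l m).map Prod.snd) = val m
  | [], m, h => by simp [List.length_eq_zero_iff.1 (Nat.le_zero.1 h), zipD]
  | a :: l, [], _ => by simpa [zipD] using val_map_snd_zipD l [] (by simp)
  | a :: l, b :: m, h => by simpa [zipD] using val_map_snd_zipD l m (by simpa using h)

/-- The digits of two numbers, with leading zeros. -/
def align (a b : Bits) : List (Bool × Bool) := zipD false (a ++ b.map fun _ => false) b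

theorem val_align_fst (a b : Bits) : val ((align a b).map Prod.fst) = val a := by
  rw [align, map_fst_zipD, val_append_zeros]

theorem val_align_snd (a b : Bits) : val ((align a b).map Prod.snd) = val b :=
  val_map_snd_zipD _ _ (by simp)

theorem length_align (a b : Bits) : (align a b).length = a.length + b.length := by
  rw [← List.length_map (f := Prod.fst), align, map_fst_zipD]
  simp

/-- Comparison of binary numbers. -/
def leB (a b : Bits) : Bool :=
  (align a b).foldl (fun r p => bif p.1 == p.2 then r else p.2) true

/-- The digits come least significant first, so the last pair of different digits decides; `r` is
the verdict on the lower digits and matters only when the rest is equal. -/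
theorem leB_eq (a b : Bits) : leB a b = decide (val a ≤ val b) := by
  have h : ∀ (l : List (Bool × Bool)) (r : Bool),
      l.foldl (fun r p => bif p.1 == p.2 then r else p.2) r =
        decide (val (l.map Prod.fst) < val (l.map Prod.snd) ∨
          val (l.map Prod.fst) = val (l.map Prod.snd) ∧ r = true) := by
    intro l
    induction l with
    | nil => intro r; simp
    | cons p l ih =>
      intro r
      obtain ⟨x, y⟩ := p
      rw [List.foldl_cons, ih, decide_eq_decide]
      cases x <;> cases y <;> simp <;> omega
  rw [leB, h, val_align_fst, val_align_snd]
  simp [le_iff_lt_or_eq]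

/-- Equality of binary numbers. -/
def eqB (a b : Bits) : Bool := leB a b && leB b a

theorem eqB_eq (a b : Bits) : eqB a b = decide (val a = val b) := by
  rw [eqB, leB_eq, leB_eq, ← Bool.decide_and, decide_eq_decide, Nat.le_antisymm_iff]

/-- One step of the addition of binary numbers: the carry and the digits of the sum in reverse. -/
def addStep (s : Bool × Bits) (p : Bool × Bool) : Bool × Bits :=
  (bif p.1 then p.2 || s.1 else p.2 && s.1, ((p.1 ^^ p.2) ^^ s.1) :: s.2)

/-- Addition of binary numbers. -/
def addB (a b : Bits) : Bits :=
  (((align a b).foldl addStep (false, [])).1 :: ((align a b).foldl addStep (false, [])).2).reverse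

theorem val_addB (a b : Bits) : val (addB a b) = val a + val b := by
  have h : ∀ (l : List (Bool × Bool)) (c : Bool), ∃ m : Bits,
      (∀ k, l.foldl addStep (c, k) = ((l.foldl addStep (c, [])).1, m.reverse ++ k)) ∧
      val (m ++ [(l.foldl addStep (c, [])).1]) =
        c.toNat + val (l.map Prod.fst) + val (l.map Prod.snd) := by
    intro l
    induction l with
    | nil => intro c; exact ⟨[], by simp⟩
    | cons p l ih =>
      intro c
      obtain ⟨m, h1, h2⟩ := ih (addStep (c, []) p).1
      refine ⟨((p.1 ^^ p.2) ^^ c) :: m, fun k => ?_, ?_⟩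
      · have h3 := h1 (((p.1 ^^ p.2) ^^ c) :: k)
        have h4 := h1 (((p.1 ^^ p.2) ^^ c) :: [])
        simp only [List.foldl_cons, addStep] at h3 h4 ⊢
        rw [h3, h4]
        simp
      · have h4 := h1 (((p.1 ^^ p.2) ^^ c) :: [])
        simp only [List.foldl_cons, addStep] at h2 h4 ⊢
        rw [h4, List.cons_append, val_cons, h2]
        obtain ⟨x, y⟩ := p
        cases x <;> cases y <;> cases c <;> simp <;> omega
  obtain ⟨m, h1, h2⟩ := h (align a b) false
  rw [addB, h1 [], List.reverse_cons, List.append_nil, List.reverse_reverse, h2, val_align_fst,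
    val_align_snd]
  simp

theorem length_addB (a b : Bits) : (addB a b).length = a.length + b.length + 1 := by
  have h : ∀ (l : List (Bool × Bool)) (s : Bool × Bits),
      (l.foldl addStep s).2.length = l.length + s.2.length := by
    intro l
    induction l with
    | nil => simp
    | cons p l ih => intro s; rw [List.foldl_cons, ih]; simp [addStep]; omega
  rw [addB, List.length_reverse, List.length_cons, h, length_align, List.length_nil, Nat.add_zero]

/-- The sum of a list of binary numbers. -/
def sumB (l : List Bits) : Bits := l.foldl addB []

theorem val_sumB (l : List Bits) : val (sumB l) = (l.map val).sum := by
  have h : ∀ (l : List Bits) (y : Bits), val (l.foldl addB y) = val y + (l.map val).sum := by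
    intro l
    induction l with
    | nil => simp
    | cons a l ih => intro y; rw [List.foldl_cons, ih, val_addB]; simp; omega
  rw [sumB, h]; simp

/-- One step of the increment: the carry and the digits in reverse. -/
def incStep (s : Bool × Bits) (b : Bool) : Bool × Bits := (s.1 && b, (s.1 ^^ b) :: s.2)

/-- The increment of a binary number. -/
def incB (a : Bits) : Bits :=
  (bif (a.foldl incStep (true, [])).1 then true :: (a.foldl incStep (true, [])).2
    else (a.foldl incStep (true, [])).2).reverse

/-- In contrast to `addB`, the increment produces no leading zeros, so counters are literally of the
form `Nat.bits n`. Once the carry is gone, the other digits are copied (`h0`). -/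
theorem incB_bits (n : ℕ) : incB (Nat.bits n) = Nat.bits (n + 1) := by
  have h0 : ∀ (l k : Bits), l.foldl incStep (false, k) = (false, l.reverse ++ k) := by
    intro l
    induction l with
    | nil => simp
    | cons b l ih => intro k; rw [List.foldl_cons, incStep]; simp [ih]
  have h : ∀ n k, (bif ((Nat.bits n).foldl incStep (true, k)).1
      then true :: ((Nat.bits n).foldl incStep (true, k)).2
      else ((Nat.bits n).foldl incStep (true, k)).2).reverse = k.reverse ++ Nat.bits (n + 1) := by
    intro n
    induction n using Nat.binaryRec' with
    | zero => simp
    | bit c n hn ih =>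
      intro k
      rw [Nat.bits_append_bit n c hn, List.foldl_cons, incStep]
      cases c with
      | false =>
        have h1 : Nat.bit false n + 1 = Nat.bit true n := by simp [Nat.bit_val]
        rw [h1, Nat.bits_append_bit n true (by simp)]
        simp [h0]
      | true =>
        have h1 : Nat.bit true n + 1 = Nat.bit false (n + 1) := by simp [Nat.bit_val]; ring
        rw [h1, Nat.bits_append_bit (n + 1) false (by simp)]
        have := ih (false :: k)
        simpa using this
  have := h n []
  rwa [List.reverse_nil, List.nil_append] at this

/-- The binary codes of the numbers below the length of a list. -/
def countB {α : Type} (l : List α) : List Bits :=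
  (l.foldl (fun (s : Bits × List Bits) _ => (incB s.1, s.1 :: s.2)) ([], [])).2.reverse

theorem foldl_countB {α : Type} (l : List α) : ∀ n : ℕ,
    l.foldl (fun (s : Bits × List Bits) _ => (incB s.1, s.1 :: s.2))
      (Nat.bits n, ((List.range n).map Nat.bits).reverse) =
    (Nat.bits (n + l.length), ((List.range (n + l.length)).map Nat.bits).reverse) := by
  induction l with
  | nil => intro n; rfl
  | cons a l ih =>
    intro n
    have := ih (n + 1)
    rw [List.range_succ, List.map_append, List.reverse_append] at this
    rw [List.foldl_cons, incB_bits, List.length_cons, Nat.add_comm l.length, ← Nat.add_assoc,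
      ← this]
    rfl

theorem countB_eq {α : Type} (l : List α) : countB l = (List.range l.length).map Nat.bits := by
  have h := foldl_countB l 0
  rw [Nat.zero_add] at h
  rw [countB]
  refine (congrArg (fun s : Bits × List Bits => s.2.reverse) h).trans ?_
  simp

/-! ### Parsing -/

/-- One step of the parser of `encStrings`: whether a bit of a string follows, the current string
in reverse, and the strings before it in reverse. -/
def parseStep (s : Bool × Bits × List Bits) (b : Bool) : Bool × Bits × List Bits :=
  bif s.1 then (false, b :: s.2.1, s.2.2)
  else bif b then (true, s.2.1, s.2.2) else (false, [], s.2.1.reverse :: s.2.2)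

/-- The inverse of `encStrings`. -/
def parse (x : Bits) : List Bits := (x.foldl parseStep (false, [], [])).2.2.reverse

theorem parse_encStrings (l : List Bits) : parse (encStrings l) = l := by
  have h1 : ∀ (x c : Bits) k, (encString x).foldl parseStep (false, c, k) =
      (false, [], (c.reverse ++ x) :: k) := by
    intro x
    induction x with
    | nil => intro c k; simp [encString, parseStep]
    | cons b x ih =>
      intro c k
      have : encString (b :: x) = true :: b :: encString x := by simp [encString]
      rw [this, List.foldl_cons, List.foldl_cons]
      have h2 : parseStep (parseStep (false, c, k) true) b = (false, b :: c, k) := by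
        simp [parseStep]
      rw [h2, ih]
      simp
  have h2 : ∀ (l : List Bits) k, (encStrings l).foldl parseStep (false, [], k) =
      (false, [], l.reverse ++ k) := by
    intro l
    induction l with
    | nil => intro k; rfl
    | cons x l ih =>
      intro k
      have : encStrings (x :: l) = encString x ++ encStrings l := by simp [encStrings]
      rw [this, List.foldl_append, h1, ih]
      simp
  rw [parse, h2]
  simp

/-! ### Arithmetic and parsing in polynomial time -/

section
variable {α β γ ε : Type} [Coded α] [Coded β] [Coded γ] [Coded ε]

theorem PT.foldl_bool {g : ε → List α} {i : ε → Bool} {f : ε → Bool → α → Bool} (hg : PT g)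
    (hi : PT i) (hf : PT fun x : (ε × Bool) × α => f x.1.1 x.1.2 x.2) :
    PT fun e => (g e).foldl (f e) (i e) :=
  .foldl hg hi hf ⟨3, fun e l _ => by
    rw [Polynomial.eval_ofNat]
    exact sz_bool_le _⟩

@[fun_prop]
theorem PT.align {f g : ε → Bits} (hf : PT f) (hg : PT g) : PT fun e => PLS.align (f e) (g e) :=
  .zipD false (.append hf (.map (f := fun _ _ => false) hg (by fun_prop))) hg

theorem PT.beq {f g : ε → Bool} (hf : PT f) (hg : PT g) : PT fun e => f e == g e := by
  have : PT fun e => bif f e then g e else !g e := by fun_prop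
  convert this using 2 with e
  cases f e <;> cases g e <;> rfl

theorem PT.xor {f g : ε → Bool} (hf : PT f) (hg : PT g) : PT fun e => f e ^^ g e := by
  have : PT fun e => bif f e then !g e else g e := by fun_prop
  convert this using 2 with e
  cases f e <;> cases g e <;> rfl

@[fun_prop]
theorem PT.leB {f g : ε → Bits} (hf : PT f) (hg : PT g) : PT fun e => PLS.leB (f e) (g e) :=
  .foldl_bool (f := fun _ r (p : Bool × Bool) => bif p.1 == p.2 then r else p.2) (hf.align hg)
    (by fun_prop) (.cond (.beq (by fun_prop) (by fun_prop)) (by fun_prop) (by fun_prop))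

@[fun_prop]
theorem PT.eqB {f g : ε → Bits} (hf : PT f) (hg : PT g) : PT fun e => PLS.eqB (f e) (g e) :=
  (hf.leB hg).and (hg.leB hf)

@[fun_prop]
theorem PT.addB {f g : ε → Bits} (hf : PT f) (hg : PT g) : PT fun e => PLS.addB (f e) (g e) := by
  have h : PT fun e => (PLS.align (f e) (g e)).foldl addStep (false, []) :=
    .foldl_of_le_add (f := fun _ => addStep) (hf.align hg) (by fun_prop)
      (.prodMk (by fun_prop) (.cons (.xor (.xor (by fun_prop) (by fun_prop)) (by fun_prop))
        (by fun_prop))) ⟨7, fun e s p _ => by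
      have h1 := sz_bool_le (addStep s p).1
      have h2 := sz_bool_le ((p.1 ^^ p.2) ^^ s.1)
      obtain ⟨s1, s2⟩ := s
      change sz ((addStep (s1, s2) p).1, ((p.1 ^^ p.2) ^^ s1) :: s2) ≤ _
      simp only [sz_pair, sz_cons, Polynomial.eval_ofNat] at h1 h2 ⊢
      omega⟩
  unfold PLS.addB
  fun_prop

/-- Each addition adds the length of the summand plus one to the length of the result, so all
partial sums stay linear in the size of the list. This is the bound on intermediate results for
`PT.sumB`. -/
theorem sz_sumB_le (l : List Bits) : sz (sumB l) ≤ 4 * sz l + 1 := by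
  have h : ∀ (l : List Bits) (y : Bits), (l.foldl PLS.addB y).length ≤ y.length + sz l := by
    intro l
    induction l with
    | nil => simp
    | cons a l ih =>
      intro y
      have h1 := ih (PLS.addB y a)
      have h2 := length_lt_sz a
      rw [length_addB] at h1
      rw [List.foldl_cons, sz_cons]
      omega
  have h1 := sz_bits_le (sumB l)
  have h2 := h l []
  rw [← sumB, List.length_nil] at h2
  omega

@[fun_prop]
theorem PT.sumB {f : ε → List Bits} (hf : PT f) : PT fun e => PLS.sumB (f e) := by
  obtain ⟨q, hq⟩ := hf.exists_sz_le
  refine .foldl (f := fun _ => PLS.addB) hf (by fun_prop) (by fun_prop) ⟨4 * q + 1, fun e l hl => ?_⟩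
  have h1 := sz_sumB_le l
  have h2 := sz_le_of_prefix hl
  have h3 := hq e
  simp only [Polynomial.eval_add, Polynomial.eval_mul, Polynomial.eval_one, Polynomial.eval_ofNat]
  change sz (PLS.sumB l) ≤ _
  omega

@[fun_prop]
theorem PT.incB {f : ε → Bits} (hf : PT f) : PT fun e => PLS.incB (f e) := by
  have h : PT fun e => (f e).foldl incStep (true, []) :=
    .foldl_of_le_add (f := fun _ => incStep) hf (by fun_prop)
      (.prodMk (by fun_prop) (.cons (.xor (by fun_prop) (by fun_prop))
        (by fun_prop))) ⟨7, fun e s p _ => by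
      have h1 := sz_bool_le (incStep s p).1
      have h2 := sz_bool_le (s.1 ^^ p)
      obtain ⟨s1, s2⟩ := s
      change sz ((incStep (s1, s2) p).1, (s1 ^^ p) :: s2) ≤ _
      simp only [sz_pair, sz_cons, Polynomial.eval_ofNat] at h1 h2 ⊢
      omega⟩
  unfold PLS.incB
  fun_prop

/-- A linear bound suffices for `PT.countB`, since the counter does not exceed the length of the
input list. -/
theorem length_bits_le (n : ℕ) : (Nat.bits n).length ≤ n := by
  rw [Nat.size_eq_bits_len, Nat.size_le]
  exact Nat.lt_two_pow_self

@[fun_prop]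
theorem PT.countB {f : ε → List α} (hf : PT f) : PT fun e => PLS.countB (f e) := by
  obtain ⟨q, hq⟩ := hf.exists_sz_le
  have h : PT fun e => (f e).foldl (fun (s : Bits × List Bits) _ => (PLS.incB s.1, s.1 :: s.2))
      ([], []) := by
    refine .foldl (f := fun _ (s : Bits × List Bits) _ => (PLS.incB s.1, s.1 :: s.2)) hf
      (by fun_prop) (by fun_prop) ⟨4 * q + 1 + (q * (4 * q + 1 + 1) + 1) + 1, fun e l hl => ?_⟩
    have h1 := foldl_countB l 0
    rw [Nat.zero_add] at h1
    have h2 : l.length ≤ q.eval (sz e) :=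
      hl.length_le.trans ((length_lt_sz _).le.trans (hq e))
    have h3 : ∀ n ≤ l.length, sz (Nat.bits n) ≤ 4 * q.eval (sz e) + 1 := by
      intro n hn
      have := sz_bits_le (Nat.bits n)
      have := length_bits_le n
      omega
    have h4 := sz_le_length_mul (l := ((List.range l.length).map Nat.bits).reverse)
      (B := 4 * q.eval (sz e) + 1) fun a ha => by
        obtain ⟨n, hn, rfl⟩ := List.mem_map.1 (List.mem_reverse.1 ha)
        exact h3 n (List.mem_range.1 hn).le
    rw [List.length_reverse, List.length_map, List.length_range] at h4
    have h5 := h3 _ le_rfl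
    have h6 : l.length * (4 * q.eval (sz e) + 1 + 1) ≤
        q.eval (sz e) * (4 * q.eval (sz e) + 1 + 1) := Nat.mul_le_mul_right _ h2
    refine (congrArg sz h1).trans_le ?_
    simp only [sz_pair, Polynomial.eval_add, Polynomial.eval_mul, Polynomial.eval_one,
      Polynomial.eval_ofNat]
    omega
  unfold PLS.countB
  fun_prop

theorem sz_reverse (l : List α) : sz l.reverse = sz l := by
  induction l with
  | nil => rfl
  | cons a l ih =>
    have := sz_append l.reverse [a]
    rw [List.reverse_cons, sz_cons]
    rw [sz_cons, sz_nil] at this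
    omega

@[fun_prop]
theorem PT.parse {f : ε → Bits} (hf : PT f) : PT fun e => PLS.parse (f e) := by
  have h : PT fun e => (f e).foldl parseStep (false, [], []) := by
    refine .foldl_of_le_add (f := fun _ => parseStep) hf (by fun_prop)
      (by unfold parseStep; fun_prop) ⟨7, fun e s b _ => ?_⟩
    obtain ⟨s, c, k⟩ := s
    rw [Polynomial.eval_ofNat]
    cases s <;> cases b <;>
      simp only [parseStep, cond_true, cond_false, sz_pair, sz_cons, sz_true, sz_false,
        sz_reverse, sz_nil] <;> omega
  unfold PLS.parse
  fun_prop

@[fun_prop]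
theorem PT.encString {f : ε → Bits} (hf : PT f) : PT fun e => PLS.encString (f e) :=
  .append (.flatMap (f := fun _ b => [true, b]) hf (by fun_prop)) (by fun_prop)

@[fun_prop]
theorem PT.encStrings {f : ε → List Bits} (hf : PT f) : PT fun e => PLS.encStrings (f e) :=
  .flatMap (f := fun _ => PLS.encString) hf (by fun_prop)

end

/-! ### The verifier -/

/-- The position and the distance that a label encodes. -/
def decodeLabel (x : Bits) : Bits × Bits := ((parse x).headD [], (parse x).tail.headD [])

/-- The test of a node with label `me`, where `k` is the code of the parameter, `ws` are the
weights of the edges to its neighbours, and `nb` are the labels of its neighbours. -/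
def test (k : Bits) (ws : List Bits) (me : Bits × Bits) (nb : List (Bits × Bits)) : Bool :=
  -- The weight `p.2` of the edge to `p` must be at least the distance of every `q` whose key lies
  -- between the keys of the two ends; ties count as between.
  ((zipD [] nb ws).all fun p => nb.all fun q =>
    !(leB me.1 q.1 && leB q.1 p.1.1) || leB q.2 p.2) &&
  -- The empty string is zero: a node without a smaller key in view must have distance zero.
  ((leB me.2 [] || nb.any fun q => !leB me.1 q.1) &&
  -- The head of `k` is its sign, and a negative parameter passes. The prepended least significant
  -- digit doubles the sum.
  (k.headD false || leB k.tail (false :: sumB (me.2 :: nb.map fun q => q.2))))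

/-- The verifier on the code of the parameter and a local view. -/
def verify (x : List Bits) : Bool :=
  test (x.headD []) (parse (x.tail.headD [])).tail (decodeLabel (x.tail.tail.headD []))
    (x.tail.tail.tail.map decodeLabel)

section
variable {α ε : Type} [Coded α] [Coded ε]

@[fun_prop]
theorem pt_decodeLabel {f : ε → Bits} (hf : PT f) : PT fun e => decodeLabel (f e) := by
  unfold decodeLabel
  fun_prop

theorem pt_test {k : ε → Bits} {ws : ε → List Bits} {me : ε → Bits × Bits}
    {nb : ε → List (Bits × Bits)} (hk : PT k) (hws : PT ws) (hme : PT me) (hnb : PT nb) :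
    PT fun e => test (k e) (ws e) (me e) (nb e) := by
  have h1 : PT fun e => (zipD [] (nb e) (ws e)).all fun p => (nb e).all fun q =>
      !(leB (me e).1 q.1 && leB q.1 p.1.1) || leB q.2 p.2 :=
    .all (f := fun e (p : (Bits × Bits) × Bits) => (nb e).all fun q =>
      !(leB (me e).1 q.1 && leB q.1 p.1.1) || leB q.2 p.2) (by fun_prop)
      (.all (f := fun (x : ε × (Bits × Bits) × Bits) (q : Bits × Bits) =>
        !(leB (me x.1).1 q.1 && leB q.1 x.2.1.1) || leB q.2 x.2.2) (by fun_prop) (by fun_prop))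
  have h2 : PT fun e => (nb e).any fun q => !leB (me e).1 q.1 :=
    .any (f := fun e (q : Bits × Bits) => !leB (me e).1 q.1) hnb (by fun_prop)
  have h3 : PT fun e => (nb e).map fun q => q.2 :=
    .map (f := fun e (q : Bits × Bits) => q.2) hnb (by fun_prop)
  unfold test
  fun_prop

theorem pt_verify : PT verify := by
  have h : PT fun x : List Bits => x.tail.tail.tail.map decodeLabel :=
    .map (f := fun _ => decodeLabel) (by fun_prop) (by fun_prop)
  exact pt_test (by fun_prop) (by fun_prop) (by fun_prop) h

end

/-! ### The prover -/

/-- The weights of the edges to other nodes. -/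
abbrev Row : Type := List (Bits × Bits)

/-- The state of Prim's algorithm at a node: its number, the weights of its edges, whether it
belongs to the tree, its position in the tree, and its distance to the tree. -/
abbrev Entry : Type := Bits × Row × Bool × Bits × Bits

/-- The weight of the edge to the node with number `i`. -/
def Row.weight (r : Row) (i : Bits) : Bits := ((r.filter fun p => eqB p.1 i).headD ([], [])).2

/-- The weights of the edges of a node whose part of the input is `x`. -/
def rowOf (x : Bits) : Row := zipD [] (parse x).tail (parse ((parse x).headD [])).tail

/-- The initial state: node `0` has distance zero, and the other nodes are at their distance from
node `0`. -/
def initial (nodes : List Bits) : List Entry :=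
  (zipD [] (countB nodes) (nodes.map rowOf)).map fun p =>
    (p.1, p.2, false, [], ((nodes.map rowOf).headD []).weight p.1)

/-- The nodes outside of the tree that are closest to the tree. -/
def closest (E : List Entry) : List Entry :=
  E.filter fun e => !e.2.2.1 && E.all fun e' => e'.2.2.1 || leB e.2.2.2.2 e'.2.2.2.2

/-- The update of `e` when `b` enters the tree at position `t`. -/
def relax (b : Entry) (t : Bits) (e : Entry) : Entry :=
  bif e.2.2.1 then e
  else bif eqB e.1 b.1 then (e.1, e.2.1, true, t, e.2.2.2.2)
  else (e.1, e.2.1, false, e.2.2.2.1,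
    bif leB e.2.2.2.2 (b.2.1.weight e.1) then e.2.2.2.2 else b.2.1.weight e.1)

/-- One step of Prim's algorithm. -/
def primStep (E : List Entry) (t : Bits) : List Entry :=
  match closest E with
  | [] => E
  | b :: _ => E.map (relax b t)

/-- Prim's algorithm. -/
def prim (nodes : List Bits) : List Entry := (countB nodes).foldl primStep (initial nodes)

/-- The labels of the nodes. -/
def labels (nodes : List Bits) : List Bits :=
  (prim nodes).map fun e => encString e.2.2.2.1 ++ encString e.2.2.2.2

/-- The parts of an entry have size at most `S`. -/
def Entry.Bounded (S : ℕ) (e : Entry) : Prop :=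
  sz e.1 ≤ S ∧ sz e.2.1 ≤ S ∧ sz e.2.2.2.1 ≤ S ∧ sz e.2.2.2.2 ≤ S

theorem Entry.Bounded.sz_le {S : ℕ} {e : Entry} (h : e.Bounded S) : sz e ≤ 4 * S + 7 := by
  obtain ⟨k, r, d, i, w⟩ := e
  obtain ⟨h1, h2, h3, h4⟩ := h
  have := sz_bool_le d
  simp only [sz_pair] at *
  omega

theorem Entry.bounded_sz (e : Entry) : e.Bounded (sz e) := by
  obtain ⟨k, r, d, i, w⟩ := e
  simp only [Entry.Bounded, sz_pair]
  omega

theorem Entry.Bounded.mono {S T : ℕ} {e : Entry} (h : e.Bounded S) (hST : S ≤ T) : e.Bounded T :=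
  ⟨h.1.trans hST, h.2.1.trans hST, h.2.2.1.trans hST, h.2.2.2.trans hST⟩

theorem Row.sz_weight_le (r : Row) (i : Bits) : sz (r.weight i) ≤ sz r := by
  unfold Row.weight
  cases h : r.filter fun p => eqB p.1 i with
  | nil => exact sz_pos r
  | cons p l =>
    have h1 : p ∈ r := (List.mem_filter.1 (h ▸ List.mem_cons_self : p ∈ r.filter _)).1
    have h2 := sz_lt_of_mem h1
    obtain ⟨p1, p2⟩ := p
    rw [sz_pair] at h2
    simp only [List.headD_cons]
    omega

theorem relax_bounded {S : ℕ} {b e : Entry} {t : Bits} (hb : b.Bounded S) (he : e.Bounded S)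
    (ht : sz t ≤ S) : (relax b t e).Bounded S := by
  have hw := (Row.sz_weight_le b.2.1 e.1).trans hb.2.1
  obtain ⟨h1, h2, h3, h4⟩ := he
  unfold relax
  cases e.2.2.1
  · cases eqB e.1 b.1
    · refine ⟨h1, h2, h3, ?_⟩
      change sz (bif leB e.2.2.2.2 (b.2.1.weight e.1) then e.2.2.2.2 else b.2.1.weight e.1) ≤ S
      cases leB e.2.2.2.2 (b.2.1.weight e.1)
      · exact hw
      · exact h4
    · exact ⟨h1, h2, ht, h4⟩
  · exact ⟨h1, h2, h3, h4⟩

/-- Prim's algorithm copies and compares weights but never adds them, so one bound on all parts of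
the entries survives every step. `pt_prim` needs it as the bound on intermediate results. -/
theorem foldl_primStep_bounded {S : ℕ} (l : List Bits) : ∀ E : List Entry,
    (∀ t ∈ l, sz t ≤ S) → (∀ e ∈ E, e.Bounded S) →
    (l.foldl primStep E).length = E.length ∧ ∀ e ∈ l.foldl primStep E, e.Bounded S := by
  induction l with
  | nil => intro E _ hE; exact ⟨rfl, hE⟩
  | cons t l ih =>
    intro E hl hE
    have key : (primStep E t).length = E.length ∧ ∀ e ∈ primStep E t, e.Bounded S := by
      unfold primStep
      split
      · exact ⟨rfl, hE⟩
      · next b m h =>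
        have hb : b ∈ E := (List.mem_filter.1 (h ▸ List.mem_cons_self : b ∈ closest E)).1
        refine ⟨List.length_map _, fun e he => ?_⟩
        obtain ⟨e', he', rfl⟩ := List.mem_map.1 he
        exact relax_bounded (hE b hb) (hE e' he') (hl t (by simp))
    obtain ⟨h1, h2⟩ := ih _ (fun t ht => hl t (by simp [ht])) key.2
    exact ⟨h1.trans key.1, h2⟩

/-! ### Prim's algorithm runs in polynomial time -/

section
variable {α ε : Type} [Coded α] [Coded ε]

@[fun_prop]
theorem pt_weight {r : ε → Row} {i : ε → Bits} (hr : PT r) (hi : PT i) :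
    PT fun e => (r e).weight (i e) :=
  .comp .snd (.headD (.filter (f := fun e (p : Bits × Bits) => eqB p.1 (i e)) hr
    (by fun_prop)) (by fun_prop))

theorem pt_rowOf : PT rowOf := by
  unfold rowOf
  fun_prop

theorem pt_initial : PT initial := by
  have h : PT fun nodes : List Bits => nodes.map rowOf :=
    .map (f := fun _ => rowOf) (by fun_prop) (pt_rowOf.comp .snd)
  exact .map (f := fun (nodes : List Bits) (p : Bits × Row) =>
    ((p.1, p.2, false, [], ((nodes.map rowOf).headD []).weight p.1) : Entry))
    (by fun_prop) (by fun_prop)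

theorem pt_closest : PT closest := by
  refine .filter (f := fun (E : List Entry) (e : Entry) => !e.2.2.1 &&
    E.all fun e' : Entry => e'.2.2.1 || leB e.2.2.2.2 e'.2.2.2.2) (by fun_prop)
    (.and (by fun_prop) ?_)
  exact .all (f := fun (x : List Entry × Entry) (e' : Entry) => e'.2.2.1 ||
    leB x.2.2.2.2.2 e'.2.2.2.2) (by fun_prop) (by fun_prop)

theorem pt_relax : PT fun x : (Entry × Bits) × Entry => relax x.1.1 x.1.2 x.2 := by
  have h1 : PT fun x : (Entry × Bits) × Entry => x.2.1 := by fun_prop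
  have h2 : PT fun x : (Entry × Bits) × Entry => x.2.2.1 := by fun_prop
  have h3 : PT fun x : (Entry × Bits) × Entry => x.2.2.2.1 := by fun_prop
  have h4 : PT fun x : (Entry × Bits) × Entry => x.2.2.2.2.1 := by fun_prop
  have h5 : PT fun x : (Entry × Bits) × Entry => x.2.2.2.2.2 := by fun_prop
  have h6 : PT fun x : (Entry × Bits) × Entry => x.1.1.2.1.weight x.2.1 :=
    pt_weight (by fun_prop) h1
  exact .cond h3 .snd (.cond (.eqB h1 (by fun_prop))
    (.prodMk h1 (.prodMk h2 (.prodMk (.const _) (.prodMk (by fun_prop) h5))))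
    (.prodMk h1 (.prodMk h2 (.prodMk (.const _) (.prodMk h4 (.cond (.leB h5 h6) h5 h6))))))

theorem pt_primStep : PT fun x : List Entry × Bits => primStep x.1 x.2 := by
  have h1 : PT fun y : ((Entry × List Entry) × (List Entry × Bits)) × Entry =>
      relax y.1.1.1 y.1.2.2 y.2 := by
    have h2 : PT fun y : ((Entry × List Entry) × (List Entry × Bits)) × Entry => y.1.1.1 :=
      PT.fst.comp (PT.fst.comp .fst)
    have h3 : PT fun y : ((Entry × List Entry) × (List Entry × Bits)) × Entry => y.1.2.2 :=
      PT.snd.comp (PT.snd.comp .fst)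
    exact pt_relax.comp ((h2.prodMk h3).prodMk .snd)
  have h4 : PT fun y : (Entry × List Entry) × (List Entry × Bits) =>
      y.2.1.map (relax y.1.1 y.2.2) :=
    .map (g := fun y : (Entry × List Entry) × (List Entry × Bits) => y.2.1)
      (f := fun y e => relax y.1.1 y.2.2 e) (PT.fst.comp .snd) h1
  have h5 : PT fun x : List Entry × Bits => closest x.1 := pt_closest.comp .fst
  have h6 := PT.listCases h5 PT.fst h4
  convert h6 using 2 with x
  unfold primStep
  cases closest x.1 <;> rfl

theorem pt_prim : PT prim := by
  obtain ⟨q, hq⟩ := pt_initial.exists_sz_le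
  obtain ⟨r, hr⟩ := (PT.countB (α := Bits) PT.id).exists_sz_le
  refine .foldl (g := fun nodes : List Bits => countB nodes) (f := fun _ => primStep)
    (by fun_prop) pt_initial (pt_primStep.comp (f := fun x : (List Bits × List Entry) × Bits => (x.1.2, x.2))
      ((PT.snd.comp .fst).prodMk .snd))
    ⟨q * (4 * (q + r) + 7 + 1) + 1, fun e l hl => ?_⟩
  obtain ⟨h1, h2⟩ := foldl_primStep_bounded (S := q.eval (sz e) + r.eval (sz e)) l (initial e)
    (fun t ht => by
      have := sz_lt_of_mem (hl.subset ht)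
      have := hr e
      omega)
    (fun x hx => x.bounded_sz.mono (by
      have := sz_lt_of_mem hx
      have := hq e
      omega))
  have h3 := sz_le_length_mul fun x hx => (h2 x hx).sz_le
  have h4 : (initial e).length ≤ q.eval (sz e) := (length_lt_sz _).le.trans (hq e)
  rw [h1] at h3
  refine h3.trans ?_
  simp only [Polynomial.eval_add, Polynomial.eval_mul, Polynomial.eval_one, Polynomial.eval_ofNat]
  gcongr

theorem pt_labels : PT labels :=
  .map (f := fun _ (e : Entry) => encString e.2.2.2.1 ++ encString e.2.2.2.2) pt_prim
    (by fun_prop)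

end

/-! ### The scheme -/

/-- The scheme for the parameter `k`. -/
def scheme (k : ℤ) : GPLS where
  -- The labels do not depend on `k`; only the verifier compares the certified sum with it.
  prover X v := (labels (parse X.encode)).getD v []
  verifier x := verify (encInt k :: x.state :: x.label :: x.nbrLabels)

theorem length_zipD {α β : Type} (d : β) (l : List α) (m : List β) :
    (zipD d l m).length = l.length := by
  rw [← List.length_map (f := Prod.fst), map_fst_zipD]

theorem length_labels (nodes : List Bits) : (labels nodes).length = nodes.length := by
  have h : ∀ (l : List Bits) (E : List Entry), (l.foldl primStep E).length = E.length := by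
    intro l
    induction l with
    | nil => intro E; rfl
    | cons t l ih =>
      intro E
      rw [List.foldl_cons, ih]
      unfold primStep
      split
      · rfl
      · exact List.length_map _
  rw [labels, List.length_map, prim, h, initial, List.length_map, length_zipD, countB_eq,
    List.length_map, List.length_range]

theorem efficientVerifier_scheme : EfficientVerifier scheme := by
  refine PT.turing (F := fun x => [verify (parse x)])
    (.cons (pt_verify.comp (by fun_prop)) (by fun_prop)) _ _ _ fun x => ?_
  rw [parse_encStrings]
  rfl

theorem efficientProver_scheme (yes : ℤ → Set ConfigGraph) : EfficientProver scheme yes := by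
  refine PT.turing (F := fun x => encStrings (labels (parse x).tail))
    (.encStrings (pt_labels.comp (by fun_prop))) _ _ _ fun x => ?_
  obtain ⟨⟨k, X⟩, hX⟩ := x
  -- The whole input is the code of one list whose head is the code of `k`, so parsing and taking
  -- the tail discards the parameter.
  have h1 : encString (encInt k) ++ X.encode = encStrings (encInt k :: parse X.encode) := by
    rw [ConfigGraph.encode, parse_encStrings]
    simp [encStrings]
  dsimp only
  rw [h1, parse_encStrings, List.tail_cons]
  congr 1
  have h2 : (labels (parse X.encode)).length = X.G.n := by
    rw [length_labels, ConfigGraph.encode, parse_encStrings, List.length_ofFn]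
  refine List.ext_getElem (by simp [h2]) fun i hi hi' => ?_
  simp [scheme, hi']

/-! ### Costs of paths -/

/-- The sum of the costs of consecutive elements. -/
def pathCost {V : Type} (f : V → V → ℕ) : List V → ℕ
  | [] => 0
  | [_] => 0
  | a :: b :: l => f a b + pathCost f (b :: l)

section
variable {V : Type} {f g : V → V → ℕ}

theorem pathCost_cons_cons (a b : V) (l : List V) :
    pathCost f (a :: b :: l) = f a b + pathCost f (b :: l) := rfl

theorem pathCost_mono (h : ∀ a b, f a b ≤ g a b) : ∀ l, pathCost f l ≤ pathCost g l
  | [] => le_rfl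
  | [_] => le_rfl
  | a :: b :: l => Nat.add_le_add (h a b) (pathCost_mono h (b :: l))

theorem pathCost_tail_le : ∀ l, pathCost f l.tail ≤ pathCost f l
  | [] => le_rfl
  | [_] => le_rfl
  | _ :: _ :: _ => Nat.le_add_left _ _

/-- Removing an element from a path. -/
theorem pathCost_remove {m : V} {c : ℕ} : ∀ (l k : List V), l ++ k ≠ [] →
    (∀ a ∈ l ++ k, c ≤ f a m ∧ c ≤ f m a) →
    (∀ a ∈ l ++ k, ∀ b ∈ l ++ k, f a b + c ≤ f a m + f m b) →
    pathCost f (l ++ k) + c ≤ pathCost f (l ++ m :: k)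
  | [], [], h, _, _ => absurd rfl h
  | [], b :: k, _, h, _ => by
    have := (h b (by simp)).2
    simp only [List.nil_append, pathCost_cons_cons]
    omega
  | [a], [], _, h, _ => by
    have := (h a (by simp)).1
    simpa [pathCost] using this
  | [a], b :: k, _, _, h => by
    have := h a (by simp) b (by simp)
    simp only [List.cons_append, List.nil_append, pathCost_cons_cons]
    omega
  | a :: a' :: l, k, _, h, h' => by
    have := pathCost_remove (m := m) (c := c) (a' :: l) k (by simp)
      (fun x hx => h x (List.mem_cons_of_mem _ hx))
      (fun x hx y hy => h' x (List.mem_cons_of_mem _ hx) y (List.mem_cons_of_mem _ hy))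
    simp only [List.cons_append, pathCost_cons_cons] at this ⊢
    omega

/-- Inserting an element into a path. -/
theorem pathCost_insert (hs : ∀ a b, f a b = f b a) (ht : ∀ a b c, f a c ≤ f a b + f b c)
    {u v : V} : ∀ (l k : List V), k ≠ [] →
    pathCost f (l ++ u :: v :: k) ≤ pathCost f (l ++ u :: k) + 2 * f u v
  | _, [], h => absurd rfl h
  | [], b :: k, _ => by
    have := ht v u b
    have := hs u v
    simp only [List.nil_append, pathCost_cons_cons]
    omega
  | [a], b :: k, h => by
    have := pathCost_insert hs ht (u := u) (v := v) [] (b :: k) h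
    simp only [List.cons_append, List.nil_append, pathCost_cons_cons] at this ⊢
    omega
  | a :: a' :: l, b :: k, h => by
    have := pathCost_insert hs ht (u := u) (v := v) (a' :: l) (b :: k) h
    simp only [List.cons_append, pathCost_cons_cons] at this ⊢
    omega

variable [Fintype V]

/-- The largest value of `d` at a position that separates `a` from `b`. -/
def bottleneck (pos d : V → ℕ) (a b : V) : ℕ :=
  (Finset.univ.filter fun q => min (pos a) (pos b) < pos q ∧ pos q ≤ max (pos a) (pos b)).sup d

/-- Induction by deleting the element `M` of largest position other than `m`. Every edge at `M`
crosses position `M` and costs at least `d M`. If `M` lies between `a` and `b` with `pos a ≤ pos b`,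
the edge from `a` to `M` crosses all that the shortcut from `a` to `b` crosses, and the edge from
`M` to `b` still pays `d M`. In the end only `m` is left. -/
theorem sum_le_pathCost_bottleneck (pos d : V → ℕ) (hpos : Function.Injective pos) :
    ∀ (n : ℕ) (l : List V), l.length = n → l.Nodup → ∀ m ∈ l, (∀ x ∈ l, pos m ≤ pos x) →
      (l.map d).sum ≤ d m + pathCost (bottleneck pos d) l := by
  classical
  intro n
  induction n with
  | zero =>
    intro l hl _ m hm
    simp [List.length_eq_zero_iff.1 hl] at hm
  | succ n ih =>
    intro l hl hnd m hm hmin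
    rcases Nat.eq_zero_or_pos n with rfl | hn
    · obtain ⟨x, rfl⟩ := List.length_eq_one_iff.1 hl
      simp at hm
      simp [hm]
    have hne : (l.toFinset.erase m).Nonempty := by
      rw [← Finset.card_pos, Finset.card_erase_of_mem (by simpa using hm),
        List.toFinset_card_of_nodup hnd]
      omega
    obtain ⟨M, hM, hmax⟩ := Finset.exists_max_image _ pos hne
    rw [Finset.mem_erase, List.mem_toFinset] at hM
    obtain ⟨k, k', rfl⟩ := List.append_of_mem hM.2
    have hnd' : M ∉ k ++ k' ∧ (k ++ k').Nodup := by
      have := List.nodup_middle.1 hnd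
      exact List.nodup_cons.1 this
    have hm' : m ∈ k ++ k' := by
      simp only [List.mem_append, List.mem_cons] at hm ⊢
      have := hM.1
      tauto
    have hlt : ∀ a ∈ k ++ k', pos a < pos M := by
      intro a ha
      have haM : a ≠ M := fun h => hnd'.1 (h ▸ ha)
      refine lt_of_le_of_ne ?_ fun h => haM (hpos h)
      by_cases ham : a = m
      · exact ham ▸ hmin M hM.2
      · refine hmax a (Finset.mem_erase.2 ⟨ham, List.mem_toFinset.2 ?_⟩)
        simp only [List.mem_append, List.mem_cons] at ha ⊢
        tauto
    have h1 := ih (k ++ k') (by simp at hl ⊢; omega) hnd'.2 m hm' fun x hx => hmin x (by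
      simp only [List.mem_append, List.mem_cons] at hx ⊢
      tauto)
    have h2 := pathCost_remove (f := bottleneck pos d) (m := M) (c := d M) k k'
      (List.ne_nil_of_mem hm') ?_ ?_
    · simp only [List.map_append, List.map_cons, List.sum_append, List.sum_cons] at h1 ⊢
      omega
    · intro a ha
      have := hlt a ha
      exact ⟨Finset.le_sup (f := d) (by simp; omega), Finset.le_sup (f := d) (by simp; omega)⟩
    · intro a ha b hb
      have h3 := hlt a ha
      have h4 := hlt b hb
      rcases le_total (pos a) (pos b) with h | h
      · refine Nat.add_le_add (Finset.sup_mono fun q => ?_) (Finset.le_sup (f := d) (by simp; omega))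
        simp only [Finset.mem_filter_univ]
        omega
      · rw [Nat.add_comm]
        refine Nat.add_le_add (Finset.le_sup (f := d) (by simp; omega)) (Finset.sup_mono fun q => ?_)
        simp only [Finset.mem_filter_univ]
        omega

/-- If the cost of an edge is at least the value of `d` at every position that the edge crosses,
then the values of `d`, except at the first position, are a lower bound for spanning paths. -/
theorem sum_le_pathCost {pos d : V → ℕ} (hpos : Function.Injective pos)
    (hs : ∀ a b, f a b = f b a)
    (hf : ∀ a q p, pos a < pos q → pos q ≤ pos p → d q ≤ f a p) {m : V} (hm : d m = 0)
    (hmin : ∀ x, pos m ≤ pos x) {l : List V} (hnd : l.Nodup) (hl : ∀ v, v ∈ l) :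
    ∑ v, d v ≤ pathCost f l := by
  classical
  have h1 := sum_le_pathCost_bottleneck pos d hpos _ l rfl hnd m (hl m) fun x _ => hmin x
  have h2 : ∀ a b, bottleneck pos d a b ≤ f a b := fun a b => Finset.sup_le fun q hq => by
    rw [Finset.mem_filter_univ] at hq
    rcases le_total (pos a) (pos b) with h | h
    · exact hf a q b (by omega) (by omega)
    · rw [hs]
      exact hf b q a (by omega) (by omega)
  have h3 : ∑ v, d v = (l.map d).sum := by
    rw [← List.sum_toFinset d hnd]
    congr 1
    ext v
    simp [hl]
  rw [h3]
  have := pathCost_mono h2 l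
  omega

/-- A closed tour through all elements, built by inserting every element after its parent. -/
theorem exists_closed_tour (hs : ∀ a b, f a b = f b a) (ht : ∀ a b c, f a c ≤ f a b + f b c)
    (h0 : ∀ a, f a a = 0) {ord d : V → ℕ} (hinj : Function.Injective ord)
    (hord : ∀ v, ord v < Fintype.card V)
    (hpar : ∀ v, 0 < ord v → ∃ u, ord u < ord v ∧ f u v = d v) [Nonempty V] :
    ∃ (r : V) (l : List V), (r :: l).Nodup ∧ (∀ v, v ∈ r :: l) ∧
      pathCost f (r :: l ++ [r]) ≤ 2 * ∑ v, d v := by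
  classical
  have hsurj : ∀ t < Fintype.card V, ∃ v, ord v = t := by
    intro t ht
    have hb : Function.Bijective fun v => (⟨ord v, hord v⟩ : Fin (Fintype.card V)) :=
      (Fintype.bijective_iff_injective_and_card _).2
        ⟨fun a b h => hinj (Fin.mk.inj h), by simp⟩
    obtain ⟨v, hv⟩ := hb.2 ⟨t, ht⟩
    exact ⟨v, Fin.mk.inj hv⟩
  -- The closed tour through the elements of order at most `t` grows by the element of order `t +
  -- 1`, whose parent is already on it; the detour to the parent and back costs at most `2 * d v`.
  have key : ∀ t, t + 1 ≤ Fintype.card V → ∃ (r : V) (l : List V), (r :: l).Nodup ∧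
      (∀ v, v ∈ r :: l ↔ ord v < t + 1) ∧
      pathCost f (r :: l ++ [r]) ≤ 2 * ((r :: l).map d).sum := by
    intro t
    induction t with
    | zero =>
      intro hc
      obtain ⟨r, hr⟩ := hsurj 0 hc
      refine ⟨r, [], by simp, fun v => ?_, ?_⟩
      · rw [List.mem_singleton, Nat.zero_add, Nat.lt_one_iff]
        exact ⟨fun h => h ▸ hr, fun h => hinj (h.trans hr.symm)⟩
      · simp [pathCost, h0]
    | succ t ih =>
      intro hc
      obtain ⟨r, l, hnd, hmem, hcost⟩ := ih (by omega)
      obtain ⟨v, hv⟩ := hsurj (t + 1) (by omega)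
      obtain ⟨u, hu, hd⟩ := hpar v (by omega)
      have hvl : v ∉ r :: l := by rw [hmem]; omega
      have hul : u ∈ r :: l := by rw [hmem]; omega
      obtain ⟨k, k', hk⟩ := List.append_of_mem hul
      -- Insertion happens behind `u`, so `r` remains the first element and the closing copy of `r`
      -- still fits.
      have hhead : ∃ l', k ++ u :: v :: k' = r :: l' := by
        cases k with
        | nil => exact ⟨v :: k', by rw [(List.cons.inj hk).1]; rfl⟩
        | cons x k => exact ⟨k ++ u :: v :: k', by rw [(List.cons.inj hk).1]; rfl⟩
      obtain ⟨l', hl'⟩ := hhead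
      have hperm : (r :: l').Perm (v :: r :: l) := by
        rw [hk, ← hl']
        refine (List.Perm.append_left k (List.Perm.swap v u k')).trans ?_
        exact List.perm_middle
      refine ⟨r, l', hperm.nodup_iff.2 (List.nodup_cons.2 ⟨hvl, hnd⟩), fun x => ?_, ?_⟩
      · rw [hperm.mem_iff, List.mem_cons, hmem]
        constructor
        · rintro (rfl | h) <;> omega
        · intro h
          rcases Nat.lt_or_ge (ord x) (t + 1) with h1 | h1
          · exact .inr h1
          · exact .inl (hinj (by omega))
      · rw [(hperm.map d).sum_eq, List.map_cons, List.sum_cons]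
        have h1 := pathCost_insert hs ht (u := u) (v := v) k (k' ++ [r]) (by simp)
        have h2 : r :: l' ++ [r] = k ++ u :: v :: (k' ++ [r]) := by
          rw [← hl']; simp
        have h3 : r :: l ++ [r] = k ++ u :: (k' ++ [r]) := by
          rw [hk]; simp
        rw [h2]
        rw [h3] at hcost
        omega
  have hcard : 0 < Fintype.card V := Fintype.card_pos
  obtain ⟨r, l, hnd, hmem, hcost⟩ := key (Fintype.card V - 1) (by omega)
  have hall : ∀ v, v ∈ r :: l := fun v => by
    rw [hmem]
    have := hord v
    omega
  refine ⟨r, l, hnd, hall, ?_⟩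
  have h3 : ∑ v, d v = ((r :: l).map d).sum := by
    rw [← List.sum_toFinset d hnd]
    congr 1
    ext v
    simpa using hall v
  rwa [h3]

end

/-! ### Tours and closed lists -/

section
variable {V : Type} {G : SimpleGraph V}

theorem sum_edges_eq_pathCost (w : Sym2 V → ℕ) {a b : V} (p : G.Walk a b) :
    (p.edges.map w).sum = pathCost (fun x y => w s(x, y)) p.support := by
  induction p with
  | nil => rfl
  | cons h p ih =>
    rw [SimpleGraph.Walk.edges_cons, SimpleGraph.Walk.support_cons, List.map_cons, List.sum_cons,
      ih]
    cases p <;> rfl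

theorem exists_walk_support {b : V} (l : List V) : ∀ {a : V}, (a :: l ++ [b]).IsChain G.Adj →
    ∃ p : G.Walk a b, p.support = a :: l ++ [b] := by
  induction l with
  | nil => intro a h; exact ⟨.cons h.rel .nil, rfl⟩
  | cons x l ih =>
    intro a h
    obtain ⟨p, hp⟩ := ih h.of_cons
    exact ⟨.cons h.rel p, by rw [SimpleGraph.Walk.support_cons, hp]; rfl⟩

theorem sum_toFinset_edges [DecidableEq V] (w : Sym2 V → ℕ) {a b : V} {p : G.Walk a b}
    (hp : p.IsTrail) :
    ∑ e ∈ p.edges.toFinset, w e = pathCost (fun x y => w s(x, y)) p.support := by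
  rw [List.sum_toFinset w hp.edges_nodup, sum_edges_eq_pathCost]

/-- The closing edge cannot lie on `q`: as the first edge of `q` it would end the path after one
step, and later it would visit `b` again. -/
theorem isCycle_cons_of_isPath {a b : V} (h : G.Adj a b) {q : G.Walk b a} (hq : q.IsPath)
    (hl : 2 ≤ q.length) : (SimpleGraph.Walk.cons h q).IsCycle := by
  refine (SimpleGraph.Walk.cons_isCycle_iff q h).2 ⟨hq, fun he => ?_⟩
  cases q with
  | nil => simp at hl
  | @cons _ y _ h' q =>
    rw [SimpleGraph.Walk.cons_isPath_iff] at hq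
    rw [SimpleGraph.Walk.edges_cons, List.mem_cons] at he
    rcases he with he | he
    · have hy : y = a := by
        rcases Sym2.eq_iff.1 he with ⟨h1, h2⟩ | ⟨h1, h2⟩
        · exact absurd h1 h.ne
        · exact h1.symm
      subst hy
      have := SimpleGraph.Walk.length_eq_zero_iff.2 (SimpleGraph.Walk.isPath_iff_nil.1 hq.1)
      rw [SimpleGraph.Walk.length_cons] at hl
      omega
    · exact hq.2 (q.snd_mem_support_of_mem_edges he)

end

/-- In a complete graph, a list of all nodes is a tour. -/
theorem exists_isTour {G : PortGraph} (hG : G.graph = ⊤) (hn : 3 ≤ G.n) {r : Fin G.n}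
    {l : List (Fin G.n)} (hnd : (r :: l).Nodup) (hall : ∀ v, v ∈ r :: l)
    (w : Sym2 (Fin G.n) → ℕ) :
    ∃ C, IsTour G C ∧ ∑ e ∈ C, w e = pathCost (fun x y => w s(x, y)) (r :: l ++ [r]) := by
  have hlen : (r :: l).length = G.n := by
    have h : (r :: l).toFinset = Finset.univ := by
      ext v
      simpa using hall v
    rw [← List.toFinset_card_of_nodup hnd, h, Finset.card_univ, Fintype.card_fin]
  rw [List.length_cons] at hlen
  cases l with
  | nil => simp at hlen; omega
  | cons x l =>
    have hnd2 : (x :: l ++ [r]).Nodup := by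
      have h := List.perm_append_comm (l₁ := x :: l) (l₂ := [r])
      exact h.nodup_iff.2 hnd
    have hchain : (x :: l ++ [r]).IsChain G.graph.Adj := by
      rw [hG]
      -- Adjacency in the complete graph is inequality, so a list without repetitions is a chain.
      exact (List.Pairwise.isChain hnd2).imp fun a b h => h
    obtain ⟨q, hq⟩ := exists_walk_support l hchain
    have hadj : G.graph.Adj r x := by
      rw [hG]
      intro h
      simp [h] at hnd
    have hpath : q.IsPath := by rwa [SimpleGraph.Walk.isPath_def, hq]
    have hql : q.length + 1 = G.n := by
      have := q.length_support
      rw [hq] at this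
      simp at this hlen
      omega
    have hcyc := isCycle_cons_of_isPath hadj hpath (by omega)
    refine ⟨_, ⟨r, .cons hadj q, ?_, rfl⟩, ?_⟩
    · rw [SimpleGraph.Walk.isHamiltonianCycle_iff_isCycle_and_length_eq]
      exact ⟨hcyc, by simpa using hql⟩
    · have := sum_toFinset_edges w hcyc.isTrail
      rw [SimpleGraph.Walk.support_cons, hq] at this
      exact this

/-- Every tour contains a list of all nodes. -/
theorem IsTour.exists_list {G : PortGraph} {C : Finset (Sym2 (Fin G.n))} (hC : IsTour G C)
    (w : Sym2 (Fin G.n) → ℕ) : 3 ≤ G.n ∧ ∃ l : List (Fin G.n), l.Nodup ∧ (∀ v, v ∈ l) ∧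
      pathCost (fun x y => w s(x, y)) l ≤ ∑ e ∈ C, w e := by
  obtain ⟨a, p, hp, rfl⟩ := hC
  have h1 := (SimpleGraph.Walk.isHamiltonianCycle_iff_isCycle_and_support_count_tail_eq_one.1 hp).2
  refine ⟨?_, p.support.tail, hp.isCycle.support_nodup, fun v => ?_, ?_⟩
  · have := hp.isCycle.three_le_length
    rwa [hp.length_eq, Fintype.card_fin] at this
  · rw [← List.count_pos_iff, h1]
    exact one_pos
  · have := sum_toFinset_edges w hp.isCycle.isTrail
    refine (pathCost_tail_le _).trans (this.symm.le.trans (le_of_eq ?_))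
    congr 1

/-! ### Correctness of Prim's algorithm -/

section
variable {V : Type} [DecidableEq V]

/-- The state after `v` enters the tree at position `t`. The state of a node tells whether it
belongs to the tree, its position, and its distance to the tree. -/
def enter (δ : V → V → ℕ) (v : V) (t : ℕ) (F : V → Bool × ℕ × ℕ) (u : V) : Bool × ℕ × ℕ :=
  if (F u).1 then F u
  else if u = v then (true, t, (F u).2.2)
  else (false, (F u).2.1, min (F u).2.2 (δ v u))

/-- The invariant of Prim's algorithm when the tree has `t` nodes. -/
structure PrimInv [Fintype V] (δ : V → V → ℕ) (s : V) (t : ℕ) (F : V → Bool × ℕ × ℕ) : Prop where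
  card : (Finset.univ.filter fun v => (F v).1 = true).card = t
  lt : ∀ v, (F v).1 = true → (F v).2.1 < t
  inj : ∀ u v, (F u).1 = true → (F v).1 = true → (F u).2.1 = (F v).2.1 → u = v
  le : ∀ v u, (F v).1 = true → (F u).1 = false → (F u).2.2 ≤ δ v u
  -- The cut between the nodes that entered before `q` and all others: no edge across it is lighter
  -- than the one that brought `q` in. A node outside the tree counts as later than `q`.
  cut : ∀ a q p, (F a).1 = true → (F q).1 = true → (F a).2.1 < (F q).2.1 →
    ((F p).1 = true → (F q).2.1 ≤ (F p).2.1) → (F q).2.2 ≤ δ a p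
  root : ∀ q, (F q).1 = true → (F q).2.1 = 0 → (F q).2.2 = 0
  parent : ∀ q, (F q).1 = true → 0 < (F q).2.1 →
    ∃ a, (F a).1 = true ∧ (F a).2.1 < (F q).2.1 ∧ δ a q = (F q).2.2
  -- With an empty tree the distances are measured from `s`, which forces `s` to enter first.
  start : t = 0 → ∀ u, (F u).2.2 = δ s u
  near : ∀ u, (F u).1 = false → 0 < t → ∃ a, (F a).1 = true ∧ δ a u = (F u).2.2

variable {δ : V → V → ℕ} {v : V} {t : ℕ} {F : V → Bool × ℕ × ℕ}

theorem enter_of_mem {u : V} (h : (F u).1 = true) : enter δ v t F u = F u := by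
  simp [enter, h]

theorem enter_self (h : (F v).1 = false) : enter δ v t F v = (true, t, (F v).2.2) := by
  simp [enter, h]

theorem enter_of_ne {u : V} (h : (F u).1 = false) (hu : u ≠ v) :
    enter δ v t F u = (false, (F u).2.1, min (F u).2.2 (δ v u)) := by
  simp [enter, h, hu]

theorem enter_fst_eq_true {u : V} (h : (enter δ v t F u).1 = true) : (F u).1 = true ∨ u = v := by
  unfold enter at h
  split_ifs at h with h1 h2
  · exact .inl h1
  · exact .inr h2

theorem enter_fst_eq_false {u : V} (h : (enter δ v t F u).1 = false) :
    (F u).1 = false ∧ u ≠ v := by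
  unfold enter at h
  split_ifs at h with h1 h2
  · rw [h1] at h; cases h
  · exact ⟨by simpa using h1, h2⟩

/-- The states of tree nodes are frozen, so only the entering node needs an argument. Its distance
is minimal outside the tree, and each outside distance is at most every edge from the tree, which
gives the new instance of `cut`; its parent is a tree node that attains its distance (`near`). -/
theorem PrimInv.step [Fintype V] {s : V} (h : PrimInv δ s t F) (hs : δ s s = 0)
    (hs' : ∀ u, δ s u = 0 → u = s) (hv : (F v).1 = false)
    (hmin : ∀ u, (F u).1 = false → (F v).2.2 ≤ (F u).2.2) :
    PrimInv δ s (t + 1) (enter δ v t F) := by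
  -- The minimum is at most `δ s s = 0`, and `s` is the only node at distance zero from `s`.
  have hroot : t = 0 → v = s ∧ (F v).2.2 = 0 ∧ ∀ u, (F u).1 = false := by
    intro ht
    have hno : ∀ u, (F u).1 = false := by
      intro u
      have h1 := h.card
      rw [ht, Finset.card_eq_zero, Finset.filter_eq_empty_iff] at h1
      simpa using h1 (Finset.mem_univ u)
    have h1 := hmin s (hno s)
    rw [h.start ht s, hs] at h1
    exact ⟨hs' v (by rw [← h.start ht v]; omega), by omega, hno⟩
  have hself : enter δ v t F v = (true, t, (F v).2.2) := enter_self hv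
  constructor
  · have h1 : (Finset.univ.filter fun u => (enter δ v t F u).1 = true) =
        insert v (Finset.univ.filter fun u => (F u).1 = true) := by
      ext u
      rw [Finset.mem_filter_univ, Finset.mem_insert, Finset.mem_filter_univ]
      constructor
      · exact fun hu => (enter_fst_eq_true hu).symm
      · rintro (rfl | hu)
        · rw [hself]
        · rwa [enter_of_mem hu]
    rw [h1, Finset.card_insert_of_notMem (by simp [hv]), h.card]
  · intro u hu
    rcases enter_fst_eq_true hu with hu | rfl
    · rw [enter_of_mem hu]
      exact (h.lt u hu).trans (Nat.lt_succ_self t)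
    · rw [hself]
      exact Nat.lt_succ_self t
  · intro u u' hu hu' he
    rcases enter_fst_eq_true hu with h1 | rfl <;> rcases enter_fst_eq_true hu' with h2 | rfl
    · rw [enter_of_mem h1, enter_of_mem h2] at he
      exact h.inj u u' h1 h2 he
    · rw [enter_of_mem h1, hself] at he
      exact absurd he (h.lt u h1).ne
    · rw [enter_of_mem h2, hself] at he
      exact absurd he.symm (h.lt u' h2).ne
    · rfl
  · intro a u ha hu
    obtain ⟨hu, huv⟩ := enter_fst_eq_false hu
    rw [enter_of_ne hu huv]
    rcases enter_fst_eq_true ha with ha | rfl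
    · exact (min_le_left _ _).trans (h.le a u ha hu)
    · exact min_le_right _ _
  · intro a q p ha hq hlt hp
    rcases enter_fst_eq_true ha with h1 | rfl
    · rw [enter_of_mem h1] at hlt
      rcases enter_fst_eq_true hq with hq | rfl
      · rw [enter_of_mem hq] at hlt hp ⊢
        refine h.cut a q p h1 hq hlt fun hp' => ?_
        rw [enter_of_mem hp'] at hp
        exact hp hp'
      · rw [hself] at hlt hp ⊢
        -- Here `q` is the entering node, at position `t`. All old tree nodes are earlier, so `p` is
        -- outside the old tree (possibly `q` itself) and the minimality of `q` applies.
        cases hpF : (F p).1 with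
        | true =>
          rw [enter_of_mem hpF] at hp
          exact absurd (hp hpF) (h.lt p hpF).not_ge
        | false => exact (hmin p hpF).trans (h.le a p h1 hpF)
    · rw [hself] at hlt
      rcases enter_fst_eq_true hq with hq | rfl
      · rw [enter_of_mem hq] at hlt
        exact absurd hlt (h.lt q hq).not_gt
      · rw [hself] at hlt
        exact absurd hlt (lt_irrefl _)
  · intro q hq h0
    rcases enter_fst_eq_true hq with hq | rfl
    · rw [enter_of_mem hq] at h0 ⊢
      exact h.root q hq h0
    · rw [hself] at h0 ⊢
      exact (hroot h0).2.1
  · intro q hq h0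
    rcases enter_fst_eq_true hq with hq | rfl
    · rw [enter_of_mem hq] at h0 ⊢
      obtain ⟨a, ha, h1, h2⟩ := h.parent q hq h0
      exact ⟨a, by rwa [enter_of_mem ha], by rwa [enter_of_mem ha], h2⟩
    · rw [hself] at h0 ⊢
      obtain ⟨a, ha, h2⟩ := h.near q hv h0
      exact ⟨a, by rwa [enter_of_mem ha], by rw [enter_of_mem ha]; exact h.lt a ha, h2⟩
  · intro h0
    exact absurd h0 (Nat.succ_ne_zero t)
  · intro u hu _
    obtain ⟨hu, huv⟩ := enter_fst_eq_false hu
    rw [enter_of_ne hu huv]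
    rcases le_total (F u).2.2 (δ v u) with hle | hle
    · rw [min_eq_left hle]
      rcases Nat.eq_zero_or_pos t with ht | ht
      · refine ⟨v, by rw [hself], ?_⟩
        rw [h.start ht u, (hroot ht).1]
      · obtain ⟨a, ha, h2⟩ := h.near u hu ht
        exact ⟨a, by rwa [enter_of_mem ha], h2⟩
    · rw [min_eq_right hle]
      exact ⟨v, by rw [hself], rfl⟩

end

/-! ### The program on bit strings follows the abstract algorithm -/

section
variable {n : ℕ} {δ : Fin n → Fin n → ℕ} {row : Fin n → Row}

/-- The entry of a node in the given state. -/
def entry (row : Fin n → Row) (v : Fin n) (p : Bool × ℕ × ℕ) : Entry :=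
  (Nat.bits v, row v, p.1, Nat.bits p.2.1, Nat.bits p.2.2)

/-- The list of the entries of all nodes. -/
def entries (row : Fin n → Row) (F : Fin n → Bool × ℕ × ℕ) : List Entry :=
  (List.finRange n).map fun v => entry row v (F v)

theorem relax_entry (hrow : ∀ v u : Fin n, (row v).weight (Nat.bits u) = Nat.bits (δ v u))
    {v : Fin n} {t : ℕ} {F : Fin n → Bool × ℕ × ℕ} (u : Fin n) :
    relax (entry row v (F v)) (Nat.bits t) (entry row u (F u)) =
      entry row u (enter δ v t F u) := by
  unfold relax
  simp only [entry, hrow, eqB_eq, leB_eq, val_bits, Fin.val_inj]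
  cases hu : (F u).1 with
  | true => simp [enter_of_mem hu, hu]
  | false =>
    by_cases huv : u = v
    · subst huv
      simp [enter_self hu]
    · simp only [enter_of_ne hu huv, huv, decide_false, cond_false]
      congr 5
      by_cases h : (F u).2.2 ≤ δ v u
      · simp [h]
      · simp [h, (not_le.1 h).le]

theorem mem_closest_entries {F : Fin n → Bool × ℕ × ℕ} {b : Entry} :
    b ∈ closest (entries row F) ↔ ∃ v, b = entry row v (F v) ∧ (F v).1 = false ∧
      ∀ u, (F u).1 = false → (F v).2.2 ≤ (F u).2.2 := by
  unfold closest
  rw [List.mem_filter, Bool.and_eq_true, List.all_eq_true]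
  simp only [entries, List.mem_map, List.mem_finRange, true_and, forall_exists_index,
    forall_apply_eq_imp_iff]
  constructor
  · rintro ⟨⟨v, rfl⟩, h1, h2⟩
    refine ⟨v, rfl, by simpa [entry] using h1, fun u hu => ?_⟩
    simpa [entry, hu, leB_eq] using h2 u
  · rintro ⟨v, rfl, h1, h2⟩
    refine ⟨⟨v, rfl⟩, by simpa [entry] using h1, fun u => ?_⟩
    cases hu : (F u).1 with
    | true => simp [entry, hu]
    | false => simpa [entry, hu, leB_eq] using h2 u hu

theorem exists_primStep (hrow : ∀ v u : Fin n, (row v).weight (Nat.bits u) = Nat.bits (δ v u))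
    {s : Fin n} {t : ℕ} {F : Fin n → Bool × ℕ × ℕ} (h : PrimInv δ s t F) (ht : t < n)
    (hs : δ s s = 0) (hs' : ∀ u, δ s u = 0 → u = s) :
    ∃ F', PrimInv δ s (t + 1) F' ∧ primStep (entries row F) (Nat.bits t) = entries row F' := by
  have hne : (Finset.univ.filter fun v => (F v).1 = false).Nonempty := by
    by_contra hcon
    rw [Finset.not_nonempty_iff_eq_empty, Finset.filter_eq_empty_iff] at hcon
    have h1 : (Finset.univ.filter fun v => (F v).1 = true) = Finset.univ := by
      rw [Finset.filter_eq_self]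
      intro v hv
      simpa using hcon hv
    have h2 := h.card
    rw [h1, Finset.card_univ, Fintype.card_fin] at h2
    omega
  obtain ⟨v, hv, hmin⟩ := Finset.exists_min_image _ (fun v => (F v).2.2) hne
  have hmem : entry row v (F v) ∈ closest (entries row F) :=
    mem_closest_entries.2 ⟨v, rfl, by simpa using hv, fun u hu => hmin u (by simpa using hu)⟩
  unfold primStep
  split
  · next h0 =>
    rw [h0] at hmem
    simp at hmem
  · next b l h0 =>
    -- The program takes the first of the closest nodes; the invariant holds for whichever minimizer
    -- this is.
    obtain ⟨v, rfl, hv, hmin⟩ := mem_closest_entries.1 (h0 ▸ List.mem_cons_self)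
    refine ⟨_, h.step hs hs' hv hmin, ?_⟩
    rw [entries, List.map_map]
    exact List.map_congr_left fun u _ => relax_entry hrow u

theorem exists_prim (hrow : ∀ v u : Fin n, (row v).weight (Nat.bits u) = Nat.bits (δ v u))
    {s : Fin n} (hs0 : s.val = 0) (hs : δ s s = 0) (hs' : ∀ u, δ s u = 0 → u = s)
    {node : Fin n → Bits} (hnode : ∀ v, rowOf (node v) = row v) :
    ∃ F, PrimInv δ s n F ∧ prim ((List.finRange n).map node) = entries row F := by
  have hinit : initial ((List.finRange n).map node) =
      entries row fun v => (false, 0, δ s v) := by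
    have h1 : ((List.finRange n).map node).map rowOf = (List.finRange n).map row := by
      rw [List.map_map]
      exact List.map_congr_left fun v _ => hnode v
    have h2 : countB ((List.finRange n).map node) =
        (List.finRange n).map fun v => Nat.bits v.val := by
      rw [countB_eq, List.length_map, List.length_finRange, ← List.map_coe_finRange_eq_range,
        List.map_map]
      rfl
    have h3 : ((List.finRange n).map row).headD [] = row s := by
      obtain ⟨m, rfl⟩ : ∃ m, n = m + 1 := ⟨n - 1, by have := s.2; omega⟩
      rw [List.finRange_succ, List.map_cons, List.headD_cons]
      congr 1
      exact Fin.ext hs0.symm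
    rw [initial, h1, h2, h3, zipD_eq_zip _ (by simp), List.zip_map', List.map_map]
    refine List.map_congr_left fun v _ => ?_
    simp [entry, hrow]
  have key : ∀ t ≤ n, ∃ F, PrimInv δ s t F ∧
      ((List.range t).map Nat.bits).foldl primStep (initial ((List.finRange n).map node)) =
        entries row F := by
    intro t
    induction t with
    | zero =>
      intro _
      refine ⟨fun v => (false, 0, δ s v), ?_, hinit⟩
      constructor <;> simp
    | succ t ih =>
      intro ht
      obtain ⟨F, hF, h⟩ := ih (by omega)
      obtain ⟨F', hF', h'⟩ := exists_primStep hrow hF (by omega) hs hs'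
      refine ⟨F', hF', ?_⟩
      rw [List.range_succ, List.map_append, List.foldl_append, h]
      exact h'
  obtain ⟨F, hF, h⟩ := key n le_rfl
  refine ⟨F, hF, ?_⟩
  rw [prim, countB_eq, List.length_map, List.length_finRange, h]

/-- The labels encode positions and distances such that the distances are bounded by the edges
that leave the initial segments, and are attained by an edge to a smaller position. -/
theorem exists_labels (hrow : ∀ v u : Fin n, (row v).weight (Nat.bits u) = Nat.bits (δ v u))
    {s : Fin n} (hs0 : s.val = 0) (hs : δ s s = 0) (hs' : ∀ u, δ s u = 0 → u = s)
    {node : Fin n → Bits} (hnode : ∀ v, rowOf (node v) = row v) :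
    ∃ ord d : Fin n → ℕ, Function.Injective ord ∧ (∀ v, ord v < n) ∧
      (∀ a q p, ord a < ord q → ord q ≤ ord p → d q ≤ δ a p) ∧
      (∀ v, ord v = 0 → d v = 0) ∧ (∀ v, 0 < ord v → ∃ u, ord u < ord v ∧ δ u v = d v) ∧
      labels ((List.finRange n).map node) = (List.finRange n).map fun v =>
        encString (Nat.bits (ord v)) ++ encString (Nat.bits (d v)) := by
  obtain ⟨F, hF, h⟩ := exists_prim hrow hs0 hs hs' hnode
  have hall : ∀ v, (F v).1 = true := by
    have h1 : (Finset.univ.filter fun v => (F v).1 = true) = Finset.univ := by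
      rw [← Finset.card_eq_iff_eq_univ, hF.card, Fintype.card_fin]
    intro v
    have := Finset.mem_univ v
    rw [← h1, Finset.mem_filter_univ] at this
    exact this
  refine ⟨fun v => (F v).2.1, fun v => (F v).2.2, fun u v => hF.inj u v (hall u) (hall v),
    fun v => hF.lt v (hall v), fun a q p h1 h2 => hF.cut a q p (hall a) (hall q) h1 fun _ => h2,
    fun v => hF.root v (hall v), fun v hv => ?_, ?_⟩
  · obtain ⟨a, -, h1, h2⟩ := hF.parent v (hall v) hv
    exact ⟨a, h1, h2⟩
  · rw [labels, h, entries, List.map_map]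
    rfl

end

/-! ### Metric instances -/

section
variable {c : ℕ} {G : PortGraph} {S : G.Assignment} {ident : Fin G.n → ℕ}
  {w : Sym2 (Fin G.n) → ℕ}

theorem IsMetricInstance.mem_ports (h : IsMetricInstance c G S ident w) (v u : Fin G.n) :
    u ∈ G.ports v ↔ v ≠ u := by
  rw [G.mem_ports, h.complete, SimpleGraph.top_adj]

/-- The weights as a distance function on the nodes. -/
def nodeDist (w : Sym2 (Fin G.n) → ℕ) (v u : Fin G.n) : ℕ := if v = u then 0 else w s(v, u)

theorem nodeDist_self (v : Fin G.n) : nodeDist w v v = 0 := if_pos rfl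

theorem nodeDist_of_ne {v u : Fin G.n} (h : v ≠ u) : nodeDist w v u = w s(v, u) := if_neg h

theorem nodeDist_comm (v u : Fin G.n) : nodeDist w v u = nodeDist w u v := by
  unfold nodeDist
  rw [Sym2.eq_swap]
  simp [eq_comm]

theorem IsMetricInstance.nodeDist_le (h : IsMetricInstance c G S ident w) (u v x : Fin G.n) :
    nodeDist w u x ≤ nodeDist w u v + nodeDist w v x := by
  by_cases h1 : u = x
  · simp [h1, nodeDist_self]
  by_cases h2 : u = v
  · simp [h2, nodeDist_self]
  by_cases h3 : v = x
  · simp [h3, nodeDist_self]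
  rw [nodeDist_of_ne h1, nodeDist_of_ne h2, nodeDist_of_ne h3]
  exact h.triangle u v x (by rwa [h.complete]) (by rwa [h.complete]) (by rwa [h.complete])

theorem IsMetricInstance.eq_of_nodeDist_eq_zero (h : IsMetricInstance c G S ident w)
    {v u : Fin G.n} (h0 : nodeDist w v u = 0) : u = v := by
  by_contra hne
  rw [nodeDist_of_ne (Ne.symm hne)] at h0
  have := h.weight_pos s(v, u) (by
    rw [SimpleGraph.mem_edgeSet, h.complete]
    exact Ne.symm hne)
  omega

theorem parse_encode (X : ConfigGraph) : parse X.encode = (List.finRange X.G.n).map fun v =>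
    encStrings (X.S v :: (X.G.ports v).map fun u => Nat.bits u.val) := by
  rw [ConfigGraph.encode, parse_encStrings, List.ofFn_eq_map]

theorem zipD_map {α β γ : Type} (d : γ) (l : List α) (f : α → β) (g : α → γ) :
    zipD d (l.map f) (l.map g) = l.map fun a => (f a, g a) := by
  rw [zipD_eq_zip d (by simp), List.zip_map']

theorem IsMetricInstance.rowOf_eq (h : IsMetricInstance c G S ident w) (v : Fin G.n) :
    rowOf (encStrings (S v :: (G.ports v).map fun u => Nat.bits u.val)) =
      (G.ports v).map fun u => (Nat.bits u.val, Nat.bits (w s(v, u))) := by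
  rw [rowOf, parse_encStrings, List.headD_cons, List.tail_cons, h.input, parse_encStrings,
    List.tail_cons, zipD_map]

/-- A node is missing from its own row, and the default of the lookup is the empty string, the code
of zero. This agrees with the diagonal of `nodeDist`. -/
theorem IsMetricInstance.weight_eq (h : IsMetricInstance c G S ident w) (v u : Fin G.n) :
    Row.weight ((G.ports v).map fun u => (Nat.bits u.val, Nat.bits (w s(v, u)))) (Nat.bits u) =
      Nat.bits (nodeDist w v u) := by
  unfold Row.weight
  have hmem : ∀ p, p ∈ ((G.ports v).map fun u => (Nat.bits u.val, Nat.bits (w s(v, u)))).filter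
      (fun p => eqB p.1 (Nat.bits u)) ↔ v ≠ u ∧ p = (Nat.bits u.val, Nat.bits (w s(v, u))) := by
    intro p
    rw [List.mem_filter, List.mem_map, eqB_eq, decide_eq_true_eq, val_bits]
    constructor
    · rintro ⟨⟨x, hx, rfl⟩, h1⟩
      rw [val_bits] at h1
      obtain rfl := Fin.ext h1
      exact ⟨(h.mem_ports v x).1 hx, rfl⟩
    · rintro ⟨hne, rfl⟩
      exact ⟨⟨u, (h.mem_ports v u).2 hne, rfl⟩, val_bits _⟩
  cases hf : ((G.ports v).map fun u => (Nat.bits u.val, Nat.bits (w s(v, u)))).filter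
      (fun p => eqB p.1 (Nat.bits u)) with
  | nil =>
    have hvu : v = u := by
      by_contra hne
      have := (hmem _).2 ⟨hne, rfl⟩
      rw [hf] at this
      simp at this
    simp [hvu, nodeDist_self]
  | cons p l =>
    obtain ⟨hne, hp⟩ := (hmem p).1 (hf ▸ List.mem_cons_self)
    rw [List.headD_cons, hp, nodeDist_of_ne hne]

theorem IsMetricInstance.exists_prover (h : IsMetricInstance c G S ident w) (k : ℤ)
    (hn : 0 < G.n) : ∃ ord d : Fin G.n → ℕ, Function.Injective ord ∧ (∀ v, ord v < G.n) ∧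
      (∀ a q p, ord a < ord q → ord q ≤ ord p → d q ≤ nodeDist w a p) ∧
      (∀ v, ord v = 0 → d v = 0) ∧
      (∀ v, 0 < ord v → ∃ u, ord u < ord v ∧ nodeDist w u v = d v) ∧
      ∀ v, (scheme k).prover ⟨G, S⟩ v = encString (Nat.bits (ord v)) ++ encString (Nat.bits (d v)) := by
  obtain ⟨ord, d, h1, h2, h3, h4, h5, h6⟩ := exists_labels (δ := nodeDist w) (s := ⟨0, hn⟩)
    h.weight_eq rfl (nodeDist_self _) (fun u => h.eq_of_nodeDist_eq_zero) h.rowOf_eq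
  refine ⟨ord, d, h1, h2, h3, h4, h5, fun v => ?_⟩
  change (labels (parse (⟨G, S⟩ : ConfigGraph).encode)).getD v [] = _
  rw [parse_encode, h6]
  simp

/-- Every tour is encoded by some output, and `metricTSP_obj` evaluates the objective with the given
`w`, so the infimum over outputs ranges over the tour weights. -/
theorem le_opt_iff (h : IsMetricInstance c G S ident w) (r : ℝ) :
    (r : EReal) ≤ (metricTSP c).opt ⟨G, S⟩ ↔
      ∀ C, IsTour G C → r ≤ ((∑ e ∈ C, w e : ℕ) : ℝ) := by
  unfold MinDGP.opt
  simp only [le_iInf_iff, EReal.coe_le_coe_iff]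
  constructor
  · intro H C hC
    obtain ⟨O, hO⟩ : ∃ O, EncodesEdges G O C := ⟨_, fun v => rfl⟩
    have := H _ ⟨ident, w, C, h, hC, hO⟩
    rw [metricTSP_obj _ h hC hO] at this
    simpa using this
  · rintro H O ⟨ident', w', C, h', hC, hO⟩
    rw [metricTSP_obj _ h hC hO]
    simpa using H C hC

/-- The position in a label. -/
def labelKey (x : Bits) : ℕ := val (decodeLabel x).1

/-- The distance in a label. -/
def labelDist (x : Bits) : ℕ := val (decodeLabel x).2

/-- The ports of `v` list all other nodes exactly once, so the sum that `v` computes locally is the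
global one. The labels are arbitrary, as soundness requires. -/
theorem IsMetricInstance.verifier_iff (h : IsMetricInstance c G S ident w) (k : ℤ)
    (L : G.Assignment) (v : Fin G.n) :
    (scheme k).verifier (localView ⟨G, S⟩ L v) = true ↔
      (∀ p, v ≠ p → ∀ q, v ≠ q → labelKey (L v) ≤ labelKey (L q) →
        labelKey (L q) ≤ labelKey (L p) → labelDist (L q) ≤ w s(v, p)) ∧
      (labelDist (L v) = 0 ∨ ∃ q, v ≠ q ∧ labelKey (L q) < labelKey (L v)) ∧
      k ≤ 2 * ∑ u, (labelDist (L u) : ℤ) := by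
  have hsum : labelDist (L v) + ((G.ports v).map fun u => labelDist (L u)).sum =
      ∑ u, labelDist (L u) := by
    have hnd : (v :: G.ports v).Nodup :=
      List.nodup_cons.2 ⟨fun hv => (h.mem_ports v v).1 hv rfl, G.nodup_ports v⟩
    have hall : (v :: G.ports v).toFinset = Finset.univ := by
      ext u
      simp only [List.mem_toFinset, List.mem_cons, h.mem_ports, Finset.mem_univ, iff_true]
      tauto
    rw [← hall, List.sum_toFinset _ hnd, List.map_cons, List.sum_cons]
  have hk : ((encInt k).headD false || leB (encInt k).tail (false :: sumB ((decodeLabel (L v)).2 ::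
      ((G.ports v).map fun u => decodeLabel (L u)).map fun q => q.2))) = true ↔
      k ≤ 2 * ∑ u, (labelDist (L u) : ℤ) := by
    have h1 : val (sumB ((decodeLabel (L v)).2 ::
        ((G.ports v).map fun u => decodeLabel (L u)).map fun q => q.2)) =
        ∑ u, labelDist (L u) := by
      rw [val_sumB, ← hsum, List.map_cons, List.sum_cons, List.map_map, List.map_map]
      rfl
    have h2 : ∑ u, (labelDist (L u) : ℤ) = ((∑ u, labelDist (L u) : ℕ) : ℤ) := by
      rw [Nat.cast_sum]
    rw [encInt, List.headD_cons, List.tail_cons, leB_eq, val_cons, h1, val_bits, h2,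
      Bool.or_eq_true, decide_eq_true_eq, decide_eq_true_eq, Bool.toNat_false]
    omega
  have hv : (scheme k).verifier (localView ⟨G, S⟩ L v) = test (encInt k)
      ((G.ports v).map fun u => Nat.bits (w s(v, u))) (decodeLabel (L v))
      ((G.ports v).map fun u => decodeLabel (L u)) := by
    change test (encInt k) (parse (S v)).tail (decodeLabel (L v))
      (((G.ports v).map L).map decodeLabel) = _
    rw [h.input, parse_encStrings, List.tail_cons, List.map_map]
    rfl
  rw [hv, test, zipD_map, Bool.and_eq_true, Bool.and_eq_true, hk]
  refine and_congr ?_ (and_congr ?_ Iff.rfl)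
  · simp only [List.all_eq_true, List.mem_map, forall_exists_index, and_imp,
      forall_apply_eq_imp_iff₂, h.mem_ports, leB_eq, val_bits, Bool.or_eq_true, Bool.not_eq_true',
      Bool.and_eq_false_iff, decide_eq_true_eq, decide_eq_false_iff_not]
    refine forall₂_congr fun p _ => forall₂_congr fun q _ => ?_
    unfold labelKey labelDist
    tauto
  · simp only [Bool.or_eq_true, List.any_eq_true, List.mem_map, exists_exists_and_eq_and,
      h.mem_ports, leB_eq, decide_eq_true_eq, Bool.not_eq_true', decide_eq_false_iff_not, not_le,
      val_nil, Nat.le_zero]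
    rfl

theorem IsMetricInstance.le_of_accepts (h : IsMetricInstance c G S ident w) {k : ℤ}
    {L : G.Assignment} (hL : (scheme k).Accepts ⟨G, S⟩ L) {C : Finset (Sym2 (Fin G.n))}
    (hC : IsTour G C) : k ≤ 2 * ∑ e ∈ C, (w e : ℤ) := by
  obtain ⟨hn, l, hnd, hall, hcost⟩ := hC.exists_list w
  have hL' := fun v => (h.verifier_iff k L v).1 (hL v)
  set key := fun v => labelKey (L v)
  -- Arbitrary labels may repeat keys. Ties are broken by the node number, which keeps the order of
  -- the keys; the verifier's test with `≤` covers every way of breaking ties.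
  set pos := fun v : Fin G.n => G.n * key v + v.val
  have hdiv : ∀ v, pos v / G.n = key v := fun v => by
    rw [Nat.mul_add_div (by omega), Nat.div_eq_of_lt v.2, Nat.add_zero]
  have hkey : ∀ {a b}, pos a ≤ pos b → key a ≤ key b := fun {a b} hab => by
    rw [← hdiv a, ← hdiv b]
    exact Nat.div_le_div_right hab
  have hpos : Function.Injective pos := fun a b hab => by
    have h1 : key a = key b := le_antisymm (hkey hab.le) (hkey hab.ge)
    refine Fin.ext ?_
    simp only [pos, h1] at hab
    omega
  obtain ⟨m, -, hmin⟩ := Finset.exists_min_image Finset.univ pos ⟨⟨0, by omega⟩, Finset.mem_univ _⟩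
  -- The first position has a minimal key, so the second alternative of the test fails there.
  have hm : labelDist (L m) = 0 := by
    rcases (hL' m).2.1 with h0 | ⟨q, -, hq⟩
    · exact h0
    · exact absurd (hkey (hmin q (Finset.mem_univ q))) (not_le.2 hq)
  have h1 := sum_le_pathCost (f := fun x y => w s(x, y)) (d := fun v => labelDist (L v)) hpos
    (fun a b => by rw [Sym2.eq_swap]) (fun a q p haq hqp => by
      have hne : a ≠ q := fun h0 => by rw [h0] at haq; exact lt_irrefl _ haq
      have hne' : a ≠ p := fun h0 => by rw [h0] at haq; omega
      exact (hL' a).1 p hne' q hne (hkey haq.le) (hkey hqp)) hm (fun x => hmin x (Finset.mem_univ x))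
    hnd hall
  have h2 := (hL' m).2.2
  have h3 : ∑ u, (labelDist (L u) : ℤ) ≤ ∑ e ∈ C, (w e : ℤ) := by
    exact_mod_cast h1.trans hcost
  omega

theorem decodeLabel_encString (x y : Bits) : decodeLabel (encString x ++ encString y) = (x, y) := by
  have h1 : encString x ++ encString y = encStrings [x, y] := by simp [encStrings]
  rw [h1, decodeLabel, parse_encStrings]
  rfl

/-- The two local tests are the cut and root properties of Prim's order. The bound on `k` holds
because the doubled tree yields a tour of weight at most `2 * ∑ d`. -/
theorem IsMetricInstance.accepts (h : IsMetricInstance c G S ident w) (hn : 3 ≤ G.n) {k : ℤ}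
    (hk : ∀ C, IsTour G C → k ≤ ∑ e ∈ C, (w e : ℤ)) :
    (scheme k).Accepts ⟨G, S⟩ ((scheme k).prover ⟨G, S⟩) := by
  obtain ⟨ord, d, hinj, hlt, hcut, hroot, hpar, hL⟩ := h.exists_prover k (by omega)
  have hkey : ∀ v, labelKey ((scheme k).prover ⟨G, S⟩ v) = ord v := fun v => by
    rw [hL, labelKey, decodeLabel_encString, val_bits]
  have hdist : ∀ v, labelDist ((scheme k).prover ⟨G, S⟩ v) = d v := fun v => by
    rw [hL, labelDist, decodeLabel_encString, val_bits]
  intro v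
  rw [h.verifier_iff]
  simp only [hkey, hdist]
  refine ⟨fun p hp q hq h1 h2 => ?_, ?_, ?_⟩
  · rw [← nodeDist_of_ne (w := w) hp]
    exact hcut v q p (lt_of_le_of_ne h1 fun h0 => hq (hinj h0)) h2
  · rcases Nat.eq_zero_or_pos (ord v) with h0 | h0
    · exact .inl (hroot v h0)
    · obtain ⟨u, hu, -⟩ := hpar v h0
      exact .inr ⟨u, fun h1 => by rw [h1] at hu; exact lt_irrefl _ hu, hu⟩
  · have : Nonempty (Fin G.n) := ⟨v⟩
    obtain ⟨r, l, hnd, hall, hcost⟩ := exists_closed_tour (nodeDist_comm (w := w)) h.nodeDist_le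
      nodeDist_self hinj (by simpa using hlt) hpar
    obtain ⟨C, hC, hCw⟩ := exists_isTour h.complete hn hnd hall
      -- The closed list is measured by `nodeDist`, which agrees with `w` on edges but not
      -- necessarily on the diagonal.
      (Sym2.lift ⟨nodeDist w, nodeDist_comm⟩)
    have h1 : ∑ e ∈ C, w e = ∑ e ∈ C, Sym2.lift ⟨nodeDist w, nodeDist_comm⟩ e := by
      refine Finset.sum_congr rfl fun e he => ?_
      have he' := hC.subset_edgeSet e he
      induction e using Sym2.ind with
      | _ x y => exact (nodeDist_of_ne (SimpleGraph.Adj.ne he')).symm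
    have h2 : ∑ e ∈ C, w e ≤ 2 * ∑ v, d v := by
      rw [h1, hCw]
      exact hcost
    have h3 := hk C hC
    have h4 : ∑ e ∈ C, (w e : ℤ) ≤ 2 * ∑ v, (d v : ℤ) := by exact_mod_cast h2
    omega

theorem length_bits_le_logb {x m : ℕ} (hm : 1 ≤ m) (hx : x ≤ m) :
    ((Nat.bits x).length : ℝ) ≤ Real.logb 2 m + 1 := by
  have h0 : 0 ≤ Real.logb 2 m := Real.logb_nonneg one_lt_two (by exact_mod_cast hm)
  rw [Nat.size_eq_bits_len]
  rcases Nat.eq_zero_or_pos x.size with h | h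
  · rw [h]
    push_cast
    linarith
  · obtain ⟨s, hs⟩ : ∃ s, x.size = s + 1 := ⟨x.size - 1, by omega⟩
    have h1 : 2 ^ s ≤ x := Nat.lt_size.1 (by omega)
    have h2 : (s : ℝ) ≤ Real.logb 2 m := by
      rw [Real.le_logb_iff_rpow_le one_lt_two (by exact_mod_cast hm), Real.rpow_natCast]
      exact_mod_cast h1.trans hx
    rw [hs]
    push_cast
    linarith

theorem length_encString (x : Bits) : (encString x).length = 2 * x.length + 1 := by
  induction x with
  | nil => rfl
  | cons b x ih =>
    have : encString (b :: x) = true :: b :: encString x := by simp [encString]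
    rw [this, List.length_cons, List.length_cons, ih, List.length_cons]
    ring

/-- Positions are below `n` and distances are zero or edge weights. The self-delimiting code doubles
the lengths, so a label has at most `2 log n + 2 log W + 6` bits, and `log n ≥ 1` absorbs the `6`
into the constant `8`. Labels contain no identifiers, so `c` plays no role. -/
theorem IsMetricInstance.proofSize_le (h : IsMetricInstance c G S ident w) (hn : 3 ≤ G.n) (k : ℤ)
    {W : ℕ} (hW : ∀ e ∈ G.graph.edgeSet, w e ≤ W) :
    ((scheme k).proofSize ⟨G, S⟩ : ℝ) ≤ 8 * (Real.logb 2 G.n + Real.logb 2 W) := by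
  obtain ⟨ord, d, -, hlt, -, hroot, hpar, hL⟩ := h.exists_prover k (by omega)
  have hedge : ∀ u v : Fin G.n, u ≠ v → s(u, v) ∈ G.graph.edgeSet := fun u v huv => by
    rw [SimpleGraph.mem_edgeSet, h.complete]
    exact huv
  have hW1 : 1 ≤ W := by
    have he := hedge ⟨0, by omega⟩ ⟨1, by omega⟩ (by simp)
    exact (h.weight_pos _ he).trans (hW _ he)
  have hd : ∀ v, d v ≤ W := fun v => by
    rcases Nat.eq_zero_or_pos (ord v) with h0 | h0
    · rw [hroot v h0]
      exact Nat.zero_le _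
    · obtain ⟨u, hu, h1⟩ := hpar v h0
      have huv : u ≠ v := fun h2 => by rw [h2] at hu; exact lt_irrefl _ hu
      rw [← h1, nodeDist_of_ne huv]
      exact hW _ (hedge u v huv)
  have hn2 : 2 ≤ G.n := by omega
  have hn0 : 0 < G.n := by omega
  have hn1 : 1 ≤ Real.logb 2 G.n := by
    rw [Real.le_logb_iff_rpow_le one_lt_two (by exact_mod_cast hn0),
      Real.rpow_one]
    exact_mod_cast hn2
  have hlogW : 0 ≤ Real.logb 2 W := Real.logb_nonneg one_lt_two (by exact_mod_cast hW1)
  obtain ⟨v, -, hv⟩ := Finset.exists_mem_eq_sup Finset.univ ⟨⟨0, by omega⟩, Finset.mem_univ _⟩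
    fun v => ((scheme k).prover ⟨G, S⟩ v).length
  rw [GPLS.proofSize, hv, hL, List.length_append, length_encString, length_encString]
  have h1 := length_bits_le_logb (m := G.n) hn0 (hlt v).le
  have h2 := length_bits_le_logb hW1 (hd v)
  push_cast
  linarith

end

end PLS

theorem mainTheorem10 (c : ℕ) :
    ∃ (K : ℝ) (P : ℤ → PLS.GPLS),
      PLS.SequentiallyEfficient P (PLS.metricTSP c).yesFamily ∧
      ∀ k : ℤ,
        (PLS.metricTSP c).IsADPLS 2 k (P k) ∧
        ∀ X ∈ (PLS.metricTSP c).yesFamily k,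
          ∀ (ident : Fin X.G.n → ℕ) (w : Sym2 (Fin X.G.n) → ℕ) (W : ℕ),
            PLS.IsMetricInstance c X.G X.S ident w →
            (∀ e ∈ X.G.graph.edgeSet, w e ≤ W) →
            ((P k).proofSize X : ℝ) ≤ K * (Real.logb 2 X.G.n + Real.logb 2 W) := by
  refine ⟨8, PLS.scheme, ⟨PLS.efficientProver_scheme _, PLS.efficientVerifier_scheme⟩,
    fun k => ⟨⟨?_, ?_⟩, ?_⟩⟩
  · rintro ⟨G, S⟩ ⟨⟨O, ident, w, C, h, hC, -⟩, hopt⟩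
    refine h.accepts (hC.exists_list w).1 fun C' hC' => ?_
    have := (PLS.le_opt_iff h k).1 hopt C' hC'
    exact_mod_cast this
  · rintro ⟨G, S⟩ ⟨hlegal, hno⟩ L hL
    refine hno ⟨hlegal, ?_⟩
    obtain ⟨O, ident, w, C, h, -, -⟩ := hlegal
    refine (PLS.le_opt_iff h _).2 fun C' hC' => ?_
    have := h.le_of_accepts hL hC'
    rw [div_le_iff₀ two_pos, mul_comm]
    exact_mod_cast this
  · rintro ⟨G, S⟩ ⟨⟨O, ident', w', C, -, hC, -⟩, -⟩ ident w W h hW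
    exact h.proofSize_le (hC.exists_list w).1 k hW
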